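/- Let $G\subset\mathbb R^2$ be a domain that is the interior of a smooth closed disk, i.e. there is a diffeomorphism (smooth up to the boundary, in both directions) from the closed unit disk onto $\overline G$ mapping the open unit disk onto $G$. Let $g$ be a smooth Riemannian metric on $G$ (not necessarily the Euclidean one), written as $g=e^{2u}g_0$ on $G$, where $g_0$ is a flat smooth Riemannian metric on $G$ (i.e. its Gaussian curvature vanishes) and $u:\overline G\to\mathbb R$ is continuous with $u|_{\partial G}\equiv 0$. For $p\in(1,\infty)$ let $$\mathcal K_p^+:=\mathcal K_p^+(G,g):=\bigl\|\max\{K_g,0\}\bigr\|_{L^p(G,g)}\cdot \mathrm{area}(G,g)^{1-\frac1p}\in[0,\infty],$$ where $K_g$ is the Gaussian curvature of $g$, the norm is taken with respect to the area measure of $g$, and $0\cdot\infty=0$. If $\mathcal K_p^+<2\pi$, then $$\max_{\overline G} u\;\le\;\frac12\left|\log\Bigl(1-\frac{\mathcal K_p^+}{2\pi}\Bigr)\right|+\frac{\mathcal K_p^+}{4\pi-2\mathcal K_p^+}\,q\log q,\qquad q:=\frac p{p-1}.$$ -/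

import Mathlib

open scoped ContDiff

noncomputable section

/-- The Euclidean plane, the coordinate space of all metrics below. -/
abbrev Plane : Type := EuclideanSpace ℝ (Fin 2)

/-- A field of `2 × 2` matrices on the plane: the components `g i j` of a covariant 2-tensor in the
standard coordinates. -/
abbrev TensorField : Type := Plane → Matrix (Fin 2) (Fin 2) ℝ

/-- `G` is the interior of a smooth closed disk: there is a diffeomorphism (smooth up to the
boundary in both directions) from the closed unit disk onto the closure of `G`, and it maps the
open unit disk onto `G`. -/
def IsSmoothDiskDomain (G : Set Plane) : Prop :=
  IsOpen G ∧
    ∃ φ ψ : Plane → Plane,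
      ContDiffOn ℝ ∞ φ (Metric.closedBall 0 1) ∧
      ContDiffOn ℝ ∞ ψ (closure G) ∧
      Set.BijOn φ (Metric.closedBall 0 1) (closure G) ∧
      Set.InvOn ψ φ (Metric.closedBall 0 1) (closure G) ∧
      φ '' Metric.ball 0 1 = G

/-- `g` is a smooth Riemannian metric on the open set `G`: a symmetric positive definite matrix
field with smooth components. -/
structure IsRiemannianMetricOn (g : TensorField) (G : Set Plane) : Prop where
  smooth : ∀ i j, ContDiffOn ℝ ∞ (fun x => g x i j) G
  posDef : ∀ x ∈ G, (g x).PosDef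

/-- The partial derivative of `f` in the `k`-th coordinate direction. -/
def partialD (k : Fin 2) (f : Plane → ℝ) (x : Plane) : ℝ :=
  fderiv ℝ f x (EuclideanSpace.single k 1)

/-- The Christoffel symbol `Γ^k_{ij}` of the Levi-Civita connection of `g`. -/
def christoffel (g : TensorField) (k i j : Fin 2) (x : Plane) : ℝ :=
  (1 / 2) * ∑ l, (g x)⁻¹ k l *
    (partialD i (fun y => g y j l) x + partialD j (fun y => g y i l) x
      - partialD l (fun y => g y i j) x)

/-- The `l`-th component of `R(∂_i, ∂_j) ∂_k`, where
`R(X, Y) Z = ∇_X ∇_Y Z - ∇_Y ∇_X Z - ∇_[X, Y] Z` is the curvature tensor of `g`. -/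
def curvatureComponent (g : TensorField) (i j k l : Fin 2) (x : Plane) : ℝ :=
  partialD i (christoffel g l j k) x - partialD j (christoffel g l i k) x
    + ∑ m, (christoffel g m j k x * christoffel g l i m x
      - christoffel g m i k x * christoffel g l j m x)

/-- The Gaussian curvature `K_g = g(R(∂_0, ∂_1) ∂_1, ∂_0) / det g`. -/
def gaussCurvature (g : TensorField) (x : Plane) : ℝ :=
  (∑ l, curvatureComponent g 0 1 1 l x * g x l 0) / (g x).det

/-- The metric `g` is flat on `G`: its Gaussian curvature vanishes there. -/
def IsFlatOn (g : TensorField) (G : Set Plane) : Prop :=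
  ∀ x ∈ G, gaussCurvature g x = 0

/-- The Riemannian area measure of `(G, g)`, with density `√(det g)` on `G`. -/
def areaMeasure (G : Set Plane) (g : TensorField) : MeasureTheory.Measure Plane :=
  (MeasureTheory.volume.restrict G).withDensity fun x => ENNReal.ofReal (Real.sqrt (g x).det)

/-- The quantity `𝒦_p⁺(G, g) = ‖K_g⁺‖_{L^p(G, g)} · area(G, g)^{1 - 1/p}` in `[0, ∞]`, where
`K_g⁺ = max {K_g, 0}`. -/
def curvPlus (p : ℝ) (G : Set Plane) (g : TensorField) : ENNReal :=
  MeasureTheory.eLpNorm (fun x => max (gaussCurvature g x) 0) (ENNReal.ofReal p) (areaMeasure G g)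
    * areaMeasure G g G ^ (1 - 1 / p)

end

open scoped ContDiff
open Filter Topology MeasureTheory

/-! In dimension two the connection form of an orthonormal frame determines the curvature through
its exterior derivative, and a conformal factor `e^{2u}` changes it by the Hodge dual of `du`. As
`g₀` is flat, this gives the curvature equation `-div (√det g₀ ∇u) = K_g √det g`
(`gaussCurvature_conformal`). Since `u` vanishes on the boundary, the sets `{u ≥ t}` with `t > 0`
are compact in `G`, so nothing needs to be known about either metric near the boundary.

For `t > 0` let `A(t)` and `V(t)` be the areas of `{u > t}` for `g₀` and `g`, and let `Φ(t)` be its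
total positive curvature. Formally, the curvature equation bounds the flux `∫ |∇u|` through `{u =
t}` by `Φ`. With the Cauchy–Schwarz inequality `L² ≤ (∫ |∇u|) (-A')` and the flat isoperimetric
inequality `4πA ≤ L²` this yields `4πA ≤ Φ (-A')`. As `V' = e^{2t} A'`, integration down from the
maximum gives `(1 - Φ/2π) V ≤ e^{2t} A`, hence `2 (2π - Φ) V ≤ Φ (-V')`. Hölder's inequality gives
`Φ ≤ κ (V/V₀)^{1/q}`, where `κ` is the curvature quantity and `V₀` the total area, and the
differential inequality then says that `(q/2) log (1 - (κ/2π) (V/V₀)^{1/q})` has derivative at least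
`1`. Integrating over the heights up to `M = max u` gives `M ≤ -(q/2) log (1 - κ/2π)`
(`LevelData.height_le`), and elementary estimates of the logarithm weaken this to the stated bound.

Level curves, lengths and the coarea formula never appear. Smoothed truncations of `u` between two
levels `t < s` are used as test functions, and `4πA ≤ Φ (-A')` becomes the difference inequality `4π
(s - t) A(s) ≤ Φ(t) (A(t) - A(s))`.

The isoperimetric inequality comes from a vector field. A flat metric on a disk has a local isometry
`F` to the plane, in general not injective (`IsSmoothDiskDomain.exists_developing`). For a cutoff
`h` of `F(E)`, the gradient `X` of its Newtonian potential satisfies `div X = h` and `|X|² ≤ (∫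
h)/4π` (`newtonField_bound`). Pulling `X` back by `F` and integrating by parts gives the inequality
for `E`; overlaps of `F` only make the image smaller, which helps. -/

/-- The connection form of the orthonormal frame obtained from the coordinate frame by
Gram–Schmidt, expressed through the Christoffel symbols. -/
noncomputable def connForm (g : TensorField) (i : Fin 2) (x : Plane) : ℝ :=
  Real.sqrt (g x).det / g x 0 0 * christoffel g 1 0 i x

/-! ### Calculus of coordinate partial derivatives. -/

section PartialDerivatives

variable {k : Fin 2} {f h : Plane → ℝ} {x : Plane}

theorem partialD_congr (hfh : f =ᶠ[𝓝 x] h) : partialD k f x = partialD k h x := by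
  unfold partialD; rw [hfh.fderiv_eq]

theorem HasFDerivAt.partialD {f' : Plane →L[ℝ] ℝ} (hf : HasFDerivAt f f' x) :
    partialD k f x = f' (EuclideanSpace.single k 1) := by
  unfold _root_.partialD; rw [hf.fderiv]

theorem partialD_add (hf : DifferentiableAt ℝ f x) (hh : DifferentiableAt ℝ h x) :
    partialD k (fun y => f y + h y) x = partialD k f x + partialD k h x := by
  exact (hf.hasFDerivAt.add hh.hasFDerivAt).partialD

theorem partialD_sub (hf : DifferentiableAt ℝ f x) (hh : DifferentiableAt ℝ h x) :
    partialD k (fun y => f y - h y) x = partialD k f x - partialD k h x := by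
  exact (hf.hasFDerivAt.sub hh.hasFDerivAt).partialD

theorem partialD_mul (hf : DifferentiableAt ℝ f x) (hh : DifferentiableAt ℝ h x) :
    partialD k (fun y => f y * h y) x = f x * partialD k h x + h x * partialD k f x := by
  exact (hf.hasFDerivAt.mul hh.hasFDerivAt).partialD

theorem partialD_const_mul (c : ℝ) (hf : DifferentiableAt ℝ f x) :
    partialD k (fun y => c * f y) x = c * partialD k f x := by
  rw [(hf.hasFDerivAt.const_mul c).partialD]; rfl

theorem partialD_comp {ψ : ℝ → ℝ} {ψ' : ℝ} (hψ : HasDerivAt ψ ψ' (f x))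
    (hf : DifferentiableAt ℝ f x) :
    partialD k (fun y => ψ (f y)) x = ψ' * partialD k f x := by
  exact (hψ.comp_hasFDerivAt x hf.hasFDerivAt).partialD

theorem partialD_div (hf : DifferentiableAt ℝ f x) (hh : DifferentiableAt ℝ h x) (h0 : h x ≠ 0) :
    partialD k (fun y => f y / h y) x
      = (partialD k f x * h x - f x * partialD k h x) / h x ^ 2 := by
  have h1 := partialD_comp (k := k) (hasDerivAt_inv h0) hh
  have h2 : DifferentiableAt ℝ (fun y => (h y)⁻¹) x := hh.inv h0
  simp only [div_eq_mul_inv]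
  rw [partialD_mul hf h2, h1]
  field_simp
  ring

theorem partialD_sqrt (hf : DifferentiableAt ℝ f x) (h0 : f x ≠ 0) :
    partialD k (fun y => Real.sqrt (f y)) x = partialD k f x / (2 * Real.sqrt (f x)) := by
  rw [partialD_comp (Real.hasDerivAt_sqrt h0) hf]
  ring

theorem contDiffOn_partialD {G : Set Plane} (hG : IsOpen G) (hf : ContDiffOn ℝ ∞ f G) :
    ContDiffOn ℝ ∞ (partialD k f) G :=
  (hf.fderiv_of_isOpen hG (by simp)).clm_apply contDiffOn_const

theorem partialD_comm {G : Set Plane} (hG : IsOpen G) (hf : ContDiffOn ℝ ∞ f G) (hx : x ∈ G)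
    (i j : Fin 2) : partialD i (partialD j f) x = partialD j (partialD i f) x := by
  have hd : DifferentiableAt ℝ (fderiv ℝ f) x :=
    ((hf.fderiv_of_isOpen hG (m := ∞) (by simp)).differentiableOn (by simp)).differentiableAt
      (hG.mem_nhds hx)
  have key : ∀ a b : Fin 2, partialD a (partialD b f) x
      = fderiv ℝ (fderiv ℝ f) x (EuclideanSpace.single a 1) (EuclideanSpace.single b 1) := by
    intro a b
    have := (hd.hasFDerivAt.clm_apply
      (hasFDerivAt_const (EuclideanSpace.single b (1:ℝ)) x)).partialD (k := a)
    simpa [partialD] using! this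
  rw [key, key]
  have hc : ContDiffAt ℝ ∞ f x := hf.contDiffAt (hG.mem_nhds hx)
  exact (hc.isSymmSndFDerivAt (by
    simpa using (mod_cast le_top : ((2 : ℕ∞) : WithTop ℕ∞) ≤ ∞))).eq _ _

end PartialDerivatives

/-! ### Christoffel symbols and Liouville's curvature formula. -/

section Metric

variable {G : Set Plane} {g : TensorField}

theorem IsRiemannianMetricOn.symm (hg : IsRiemannianMetricOn g G) {x : Plane} (hx : x ∈ G) :
    g x 1 0 = g x 0 1 := by
  have := (hg.posDef x hx).isHermitian.apply 0 1
  simpa using this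

theorem IsRiemannianMetricOn.det_pos (hg : IsRiemannianMetricOn g G) {x : Plane} (hx : x ∈ G) :
    0 < (g x).det := (hg.posDef x hx).det_pos

theorem IsRiemannianMetricOn.det_eq (hg : IsRiemannianMetricOn g G) {x : Plane} (hx : x ∈ G) :
    (g x).det = g x 0 0 * g x 1 1 - g x 0 1 * g x 0 1 := by
  rw [Matrix.det_fin_two, hg.symm hx]

theorem IsRiemannianMetricOn.diag_pos (hg : IsRiemannianMetricOn g G) {x : Plane} (hx : x ∈ G)
    (i : Fin 2) : 0 < g x i i := (hg.posDef x hx).diag_pos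

theorem IsRiemannianMetricOn.contDiffOn_det (hg : IsRiemannianMetricOn g G) :
    ContDiffOn ℝ ∞ (fun x => (g x).det) G := by
  simp only [Matrix.det_fin_two]
  exact ((hg.smooth 0 0).mul (hg.smooth 1 1)).sub ((hg.smooth 0 1).mul (hg.smooth 1 0))

theorem IsRiemannianMetricOn.contDiffOn_sqrt_det (hg : IsRiemannianMetricOn g G) :
    ContDiffOn ℝ ∞ (fun x => Real.sqrt (g x).det) G :=
  hg.contDiffOn_det.sqrt fun _ hx => (hg.det_pos hx).ne'

/-- The Christoffel symbols of the first kind. -/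
noncomputable def christoffelFirst (g : TensorField) (i j l : Fin 2) (x : Plane) : ℝ :=
  partialD i (fun y => g y j l) x + partialD j (fun y => g y i l) x
    - partialD l (fun y => g y i j) x

/-- Cramer's rule for the inverse matrix; `christoffelFirst` carries no factor `1/2`, hence the `2`
in the denominator. -/
theorem IsRiemannianMetricOn.christoffel_zero (hg : IsRiemannianMetricOn g G) {x : Plane}
    (hx : x ∈ G) (i j : Fin 2) : christoffel g 0 i j x
      = (g x 1 1 * christoffelFirst g i j 0 x - g x 0 1 * christoffelFirst g i j 1 x)
        / (2 * (g x).det) := by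
  have h := (hg.det_pos hx).ne'
  simp only [christoffel, Matrix.inv_def, Matrix.adjugate_fin_two, Fin.sum_univ_two,
    Matrix.smul_apply, Ring.inverse_eq_inv', christoffelFirst]
  simp
  field_simp
  ring

theorem IsRiemannianMetricOn.christoffel_one (hg : IsRiemannianMetricOn g G) {x : Plane}
    (hx : x ∈ G) (i j : Fin 2) : christoffel g 1 i j x
      = (g x 0 0 * christoffelFirst g i j 1 x - g x 0 1 * christoffelFirst g i j 0 x)
        / (2 * (g x).det) := by
  have h := (hg.det_pos hx).ne'
  simp only [christoffel, Matrix.inv_def, Matrix.adjugate_fin_two, Fin.sum_univ_two,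
    Matrix.smul_apply, Ring.inverse_eq_inv', christoffelFirst]
  simp [hg.symm hx]
  field_simp
  ring

theorem IsRiemannianMetricOn.contDiffOn_christoffelFirst (hG : IsOpen G)
    (hg : IsRiemannianMetricOn g G) (i j l : Fin 2) :
    ContDiffOn ℝ ∞ (christoffelFirst g i j l) G :=
  ((contDiffOn_partialD hG (hg.smooth _ _)).add (contDiffOn_partialD hG (hg.smooth _ _))).sub
    (contDiffOn_partialD hG (hg.smooth _ _))

theorem IsRiemannianMetricOn.contDiffOn_christoffel (hG : IsOpen G)
    (hg : IsRiemannianMetricOn g G) (i j l : Fin 2) :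
    ContDiffOn ℝ ∞ (christoffel g i j l) G := by
  have hD : ∀ x ∈ G, 2 * (g x).det ≠ 0 := fun x hx =>
    mul_ne_zero two_ne_zero (hg.det_pos hx).ne'
  have hc := hg.contDiffOn_christoffelFirst hG j l
  have h2 := (contDiffOn_const (c := (2:ℝ))).mul hg.contDiffOn_det
  fin_cases i
  · exact ((((hg.smooth 1 1).mul (hc 0)).sub ((hg.smooth 0 1).mul (hc 1))).div h2 hD).congr
      fun x hx => hg.christoffel_zero hx j l
  · exact ((((hg.smooth 0 0).mul (hc 1)).sub ((hg.smooth 0 1).mul (hc 0))).div h2 hD).congr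
      fun x hx => hg.christoffel_one hx j l

theorem IsRiemannianMetricOn.contDiffOn_connForm (hG : IsOpen G)
    (hg : IsRiemannianMetricOn g G) (i : Fin 2) : ContDiffOn ℝ ∞ (connForm g i) G :=
  (hg.contDiffOn_sqrt_det.div (hg.smooth 0 0) fun _ hx => (hg.diag_pos hx 0).ne').mul
    (hg.contDiffOn_christoffel hG 1 0 i)

theorem ContDiffOn.differentiableAt_of_isOpen {f : Plane → ℝ} {x : Plane} (hG : IsOpen G)
    (hf : ContDiffOn ℝ ∞ f G) (hx : x ∈ G) : DifferentiableAt ℝ f x :=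
  (hf.differentiableOn (by simp)).differentiableAt (hG.mem_nhds hx)

/-- Both formulas for the Christoffel symbols have this shape, so a single computation provides all
their derivatives. -/
theorem partialD_quotient {a b c d D : Plane → ℝ} {x : Plane} (k : Fin 2)
    (ha : DifferentiableAt ℝ a x) (hb : DifferentiableAt ℝ b x) (hc : DifferentiableAt ℝ c x)
    (hd : DifferentiableAt ℝ d x) (hD : DifferentiableAt ℝ D x) (h0 : D x ≠ 0) :
    partialD k (fun y => (a y * b y - c y * d y) / (2 * D y)) x
      = ((a x * partialD k b x + b x * partialD k a x - c x * partialD k d x - d x * partialD k c x)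
          * D x - (a x * b x - c x * d x) * partialD k D x) / (2 * D x ^ 2) := by
  rw [partialD_div (f := fun y => a y * b y - c y * d y) ((ha.mul hb).sub (hc.mul hd))
      (hD.const_mul 2) (mul_ne_zero two_ne_zero h0),
    partialD_sub (f := fun y => a y * b y) (h := fun y => c y * d y) (ha.mul hb) (hc.mul hd),
    partialD_mul ha hb, partialD_mul hc hd,
    partialD_const_mul _ hD]
  field_simp
  ring

/-- Liouville's formula: the Gauss curvature is the exterior derivative of the connection form. -/
theorem IsRiemannianMetricOn.partialD_connForm (hG : IsOpen G) (hg : IsRiemannianMetricOn g G)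
    {x : Plane} (hx : x ∈ G) :
    partialD 1 (connForm g 0) x - partialD 0 (connForm g 1) x
      = gaussCurvature g x * Real.sqrt (g x).det := by
  have dg : ∀ i j, DifferentiableAt ℝ (fun y => g y i j) x := fun i j =>
    (hg.smooth i j).differentiableAt_of_isOpen hG hx
  have dD := hg.contDiffOn_det.differentiableAt_of_isOpen hG hx
  have dS := hg.contDiffOn_sqrt_det.differentiableAt_of_isOpen hG hx
  have dC : ∀ i j l, DifferentiableAt ℝ (christoffelFirst g i j l) x := fun i j l =>
    (hg.contDiffOn_christoffelFirst hG i j l).differentiableAt_of_isOpen hG hx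
  have dΓ : ∀ i j l, DifferentiableAt ℝ (christoffel g i j l) x := fun i j l =>
    (hg.contDiffOn_christoffel hG i j l).differentiableAt_of_isOpen hG hx
  have dP : ∀ k i j, DifferentiableAt ℝ (partialD k (fun y => g y i j)) x := fun k i j =>
    (contDiffOn_partialD hG (hg.smooth i j)).differentiableAt_of_isOpen hG hx
  have hD := hg.det_pos hx
  have hE := hg.diag_pos hx 0
  have hev : ∀ᶠ y in 𝓝 x, y ∈ G := hG.mem_nhds hx
  have hsym : ∀ k, partialD k (fun y => g y 1 0) =ᶠ[𝓝 x] partialD k (fun y => g y 0 1) := by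
    intro k
    filter_upwards [hev] with y hy
    exact partialD_congr (by filter_upwards [hG.mem_nhds hy] with z hz using hg.symm hz)
  have hΓ0 : ∀ k i j, partialD k (christoffel g 0 i j) x = _ := fun k i j =>
    (partialD_congr (by filter_upwards [hev] with y hy using hg.christoffel_zero hy i j)).trans
      (partialD_quotient k (dg 1 1) (dC i j 0) (dg 0 1) (dC i j 1) dD hD.ne')
  have hΓ1 : ∀ k i j, partialD k (christoffel g 1 i j) x = _ := fun k i j =>
    (partialD_congr (by filter_upwards [hev] with y hy using hg.christoffel_one hy i j)).trans
      (partialD_quotient k (dg 0 0) (dC i j 1) (dg 0 1) (dC i j 0) dD hD.ne')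
  have dQ : DifferentiableAt ℝ (fun y => Real.sqrt (g y).det / g y 0 0) x :=
    (hg.contDiffOn_sqrt_det.div (hg.smooth 0 0) fun _ hy =>
      (hg.diag_pos hy 0).ne').differentiableAt_of_isOpen hG hx
  have hconn : ∀ k i, partialD k (connForm g i) x = _ := fun k i =>
    partialD_mul dQ (dΓ 1 0 i)
  have hquot : ∀ k, partialD k (fun y => Real.sqrt (g y).det / g y 0 0) x = _ := fun k =>
    (partialD_div (h := fun y => g y 0 0) dS (dg 0 0) hE.ne').trans (by rw [partialD_sqrt dD hD.ne'])
  have hdet : ∀ k, partialD k (fun y => (g y).det) x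
      = g x 0 0 * partialD k (fun y => g y 1 1) x + g x 1 1 * partialD k (fun y => g y 0 0) x
        - 2 * (g x 0 1 * partialD k (fun y => g y 0 1) x) := fun k => by
    rw [partialD_congr (h := fun y => g y 0 0 * g y 1 1 - g y 0 1 * g y 0 1)
        (by filter_upwards [hev] with y hy using hg.det_eq hy),
      partialD_sub (f := fun y => g y 0 0 * g y 1 1) (h := fun y => g y 0 1 * g y 0 1)
        ((dg 0 0).mul (dg 1 1)) ((dg 0 1).mul (dg 0 1)),
      partialD_mul (dg 0 0) (dg 1 1), partialD_mul (dg 0 1) (dg 0 1)]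
    ring
  have hCC : ∀ k i j l, partialD k (christoffelFirst g i j l) x
      = partialD k (partialD i fun y => g y j l) x + partialD k (partialD j fun y => g y i l) x
        - partialD k (partialD l fun y => g y i j) x := fun k i j l => by
    rw [← partialD_add (dP i j l) (dP j i l)]
    exact partialD_sub ((dP i j l).add (dP j i l)) (dP l i j)
  have hcomm : ∀ i j, partialD 1 (partialD 0 (fun y => g y i j)) x
      = partialD 0 (partialD 1 (fun y => g y i j)) x := fun i j =>
    partialD_comm hG (hg.smooth i j) hx 1 0
  have hsx : ∀ k, partialD k (fun y => g y 1 0) x = partialD k (fun y => g y 0 1) x :=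
    fun k => (hsym k).eq_of_nhds
  have hs2 : ∀ k l, partialD l (partialD k (fun y => g y 1 0)) x
      = partialD l (partialD k (fun y => g y 0 1)) x := fun k l => partialD_congr (hsym k)
  simp only [hconn, hquot, gaussCurvature, curvatureComponent, Fin.sum_univ_two, hΓ0, hΓ1,
    hg.christoffel_zero hx, hg.christoffel_one hx, hCC, hs2, hcomm]
  simp only [hdet, christoffelFirst, hsx, hg.symm hx]
  have hsq : Real.sqrt (g x).det ^ 2 = (g x).det := Real.sq_sqrt hD.le
  have hS := Real.sqrt_pos.2 hD
  have hDe := hg.det_eq hx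
  have hD0 := hD.ne'
  have hE0 := hE.ne'
  -- What is left is a rational identity in the 2-jet of `g` and `S = √det g`. The relation `S² =
  -- g₀₀ g₁₁ - g₀₁²` is used to eliminate `g₁₁`, after which the remaining quantities may be treated
  -- as independent variables.
  have hS0 := hS.ne'
  generalize Real.sqrt (g x).det = S at *
  generalize (g x).det = D at *
  subst hsq
  have hH : g x 1 1 = (S ^ 2 + g x 0 1 * g x 0 1) / g x 0 0 := by
    field_simp
    linarith
  rw [hH]
  field_simp
  ring

end Metric

/-! ### Curvature under a conformal change of metric. -/

/-- The components of `√(det g) ∇u`, where `∇u` is the gradient of `u` with respect to `g`. -/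
noncomputable def gradFlux (g : TensorField) (u : Plane → ℝ) : Fin 2 → Plane → ℝ :=
  ![fun x => (g x 1 1 * partialD 0 u x - g x 0 1 * partialD 1 u x) / Real.sqrt (g x).det,
    fun x => (g x 0 0 * partialD 1 u x - g x 0 1 * partialD 0 u x) / Real.sqrt (g x).det]

section Conformal

variable {G : Set Plane} {g g₀ : TensorField} {u : Plane → ℝ}

theorem contDiffOn_gradFlux (hG : IsOpen G) (hg : IsRiemannianMetricOn g G)
    (hu : ContDiffOn ℝ ∞ u G) (i : Fin 2) : ContDiffOn ℝ ∞ (gradFlux g u i) G := by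
  have h0 : ∀ x ∈ G, Real.sqrt (g x).det ≠ 0 := fun x hx => (Real.sqrt_pos.2 (hg.det_pos hx)).ne'
  have hp := fun k => contDiffOn_partialD (k := k) hG hu
  fin_cases i
  · exact (((hg.smooth 1 1).mul (hp 0)).sub ((hg.smooth 0 1).mul (hp 1))).div
      hg.contDiffOn_sqrt_det h0
  · exact (((hg.smooth 0 0).mul (hp 1)).sub ((hg.smooth 0 1).mul (hp 0))).div
      hg.contDiffOn_sqrt_det h0

/-- The factor is recovered from the metrics as `u = ½ log (g₀₀ / (g₀)₀₀)`, so its interior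
smoothness is automatic. -/
theorem contDiffOn_of_conformal (hg : IsRiemannianMetricOn g G) (hg₀ : IsRiemannianMetricOn g₀ G)
    (hconf : ∀ x ∈ G, g x = Real.exp (2 * u x) • g₀ x) : ContDiffOn ℝ ∞ u G := by
  have h : ContDiffOn ℝ ∞ (fun x => 1 / 2 * Real.log (g x 0 0 / g₀ x 0 0)) G :=
    contDiffOn_const.mul (((hg.smooth 0 0).div (hg₀.smooth 0 0) fun x hx =>
      (hg₀.diag_pos hx 0).ne').log fun x hx =>
        (div_pos (hg.diag_pos hx 0) (hg₀.diag_pos hx 0)).ne')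
  refine h.congr fun x hx => ?_
  have h0 := (hg₀.diag_pos hx 0).ne'
  rw [hconf x hx, Matrix.smul_apply, smul_eq_mul, mul_div_cancel_right₀ _ h0, Real.log_exp]
  ring

theorem sqrt_det_conformal (hconf : ∀ x ∈ G, g x = Real.exp (2 * u x) • g₀ x) {x : Plane}
    (hx : x ∈ G) :
    Real.sqrt (g x).det = Real.exp (2 * u x) * Real.sqrt (g₀ x).det := by
  rw [hconf x hx, Matrix.det_smul, Fintype.card_fin, Real.sqrt_mul (by positivity),
    Real.sqrt_sq (Real.exp_pos _).le]

theorem partialD_conformal (hG : IsOpen G) (hg₀ : IsRiemannianMetricOn g₀ G)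
    (hu : ContDiffOn ℝ ∞ u G) (hconf : ∀ x ∈ G, g x = Real.exp (2 * u x) • g₀ x) {x : Plane}
    (hx : x ∈ G) (k i j : Fin 2) :
    partialD k (fun y => g y i j) x
      = Real.exp (2 * u x) * (partialD k (fun y => g₀ y i j) x + 2 * partialD k u x * g₀ x i j) := by
  have hux := hu.differentiableAt_of_isOpen hG hx
  have h2 : DifferentiableAt ℝ (fun y => 2 * u y) x := hux.const_mul 2
  have he : DifferentiableAt ℝ (fun y => Real.exp (2 * u y)) x := h2.exp
  rw [partialD_congr (h := fun y => Real.exp (2 * u y) * g₀ y i j), partialD_mul he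
      ((hg₀.smooth i j).differentiableAt_of_isOpen hG hx),
    partialD_comp (ψ := Real.exp) (Real.hasDerivAt_exp _) h2, partialD_const_mul _ hux]
  · ring
  · filter_upwards [hG.mem_nhds hx] with y hy
    rw [hconf y hy, Matrix.smul_apply, smul_eq_mul]

/-- Scaling the metric only rescales the Gram–Schmidt frame, and the connection form changes by the
Hodge dual of `du`, whose components are the gradient flux `(-flux₁, flux₀)`. Taking exterior
derivatives turns this into the curvature equation. -/
theorem connForm_conformal (hG : IsOpen G) (hg : IsRiemannianMetricOn g G)
    (hg₀ : IsRiemannianMetricOn g₀ G)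
    (hu : ContDiffOn ℝ ∞ u G) (hconf : ∀ x ∈ G, g x = Real.exp (2 * u x) • g₀ x) {x : Plane}
    (hx : x ∈ G) :
    connForm g 0 x = connForm g₀ 0 x - gradFlux g₀ u 1 x ∧
      connForm g 1 x = connForm g₀ 1 x + gradFlux g₀ u 0 x := by
  have hD := hg₀.det_pos hx
  have hS := Real.sqrt_pos.2 hD
  have hE := hg₀.diag_pos hx 0
  have hX := Real.exp_pos (2 * u x)
  have hsq : Real.sqrt (g₀ x).det ^ 2 = (g₀ x).det := Real.sq_sqrt hD.le
  have hH : g₀ x 1 1 = (Real.sqrt (g₀ x).det ^ 2 + g₀ x 0 1 * g₀ x 0 1) / g₀ x 0 0 := by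
    have := hg₀.det_eq hx
    field_simp
    linarith
  have hdet : (g x).det = Real.exp (2 * u x) ^ 2 * (g₀ x).det := by
    rw [hconf x hx, Matrix.det_smul, Fintype.card_fin]
  have hij : ∀ i j, g x i j = Real.exp (2 * u x) * g₀ x i j := fun i j => by
    rw [hconf x hx, Matrix.smul_apply, smul_eq_mul]
  have hpd := partialD_conformal hG hg₀ hu hconf hx
  simp only [connForm, hg.christoffel_one hx, hg₀.christoffel_one hx, christoffelFirst,
    gradFlux, sqrt_det_conformal hconf hx, Matrix.cons_val_zero, Matrix.cons_val_one]
  simp only [hpd, hij, hdet]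
  have hs : ∀ k, partialD k (fun y => g₀ y 1 0) x = partialD k (fun y => g₀ y 0 1) x := fun k =>
    partialD_congr (by filter_upwards [hG.mem_nhds hx] with z hz using hg₀.symm hz)
  simp only [hs, hg₀.symm hx]
  generalize Real.exp (2 * u x) = X at *
  generalize Real.sqrt (g₀ x).det = S at *
  generalize (g₀ x).det = D at *
  subst hsq
  rw [hH]
  constructor
  · field_simp
    ring
  · field_simp
    ring

/-- The curvature of a metric conformal to a flat one, in divergence form. -/
theorem gaussCurvature_conformal (hG : IsOpen G) (hg : IsRiemannianMetricOn g G)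
    (hg₀ : IsRiemannianMetricOn g₀ G) (hflat : IsFlatOn g₀ G)
    (hconf : ∀ x ∈ G, g x = Real.exp (2 * u x) • g₀ x) {x : Plane} (hx : x ∈ G) :
    gaussCurvature g x * Real.sqrt (g x).det
      = -(partialD 0 (gradFlux g₀ u 0) x + partialD 1 (gradFlux g₀ u 1) x) := by
  have hu := contDiffOn_of_conformal hg hg₀ hconf
  have h0 := hg₀.partialD_connForm hG hx
  rw [hflat x hx, zero_mul] at h0
  have dF := fun i => (contDiffOn_gradFlux hG hg₀ hu i).differentiableAt_of_isOpen hG hx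
  have dC := fun i => (hg₀.contDiffOn_connForm hG i).differentiableAt_of_isOpen hG hx
  rw [← hg.partialD_connForm hG hx,
    partialD_congr (k := 1) (h := fun y => connForm g₀ 0 y - gradFlux g₀ u 1 y)
      (by filter_upwards [hG.mem_nhds hx] with y hy using
        (connForm_conformal hG hg hg₀ hu hconf hy).1),
    partialD_congr (k := 0) (h := fun y => connForm g₀ 1 y + gradFlux g₀ u 0 y)
      (by filter_upwards [hG.mem_nhds hx] with y hy using
        (connForm_conformal hG hg hg₀ hu hconf hy).2),
    partialD_sub (dC 0) (dF 1), partialD_add (dC 1) (dF 0)]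
  linarith

/-- Liouville's formula exhibits the curvature as a quotient of smooth functions, which avoids its
expression by curvature components. -/
theorem continuousOn_gaussCurvature (hG : IsOpen G) (hg : IsRiemannianMetricOn g G) :
    ContinuousOn (gaussCurvature g) G := by
  have h := ((contDiffOn_partialD (k := 1) hG (hg.contDiffOn_connForm hG 0)).sub
    (contDiffOn_partialD (k := 0) hG (hg.contDiffOn_connForm hG 1))).div hg.contDiffOn_sqrt_det
    (fun x hx => (Real.sqrt_pos.2 (hg.det_pos hx)).ne')
  refine h.continuousOn.congr fun x hx => ?_
  have := (Real.sqrt_pos.2 (hg.det_pos hx)).ne'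
  exact (eq_div_iff this).2 (hg.partialD_connForm hG hx).symm

end Conformal

/-! ### Poincaré lemma on a smooth disk. -/

section Poincare

variable {G : Set Plane}

/-- The Poincaré lemma transported from a convex open set by a diffeomorphism. -/
theorem exists_hasFDerivAt_of_diffeo {B : Set Plane} (hB : IsOpen B) (hBc : Convex ℝ B)
    (hG : IsOpen G) {φ ψ : Plane → Plane} (hφ : ContDiffOn ℝ ∞ φ B) (hψ : ContDiffOn ℝ ∞ ψ G)
    (hφG : Set.MapsTo φ B G) (hψB : Set.MapsTo ψ G B) (hinv : ∀ x ∈ G, φ (ψ x) = x)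
    {γ : Plane → Plane →L[ℝ] ℝ} (hγ : ContDiffOn ℝ ∞ γ G)
    (hsymm : ∀ x ∈ G, ∀ v w, fderiv ℝ γ x v w = fderiv ℝ γ x w v) :
    ∃ f : Plane → ℝ, ∀ x ∈ G, HasFDerivAt f (γ x) x := by
  have dφ : ∀ z ∈ B, DifferentiableAt ℝ φ z := fun z hz =>
    (hφ.differentiableOn (by simp)).differentiableAt (hB.mem_nhds hz)
  have dψ : ∀ z ∈ G, DifferentiableAt ℝ ψ z := fun z hz =>
    (hψ.differentiableOn (by simp)).differentiableAt (hG.mem_nhds hz)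
  have dγ : ∀ z ∈ G, DifferentiableAt ℝ γ z := fun z hz =>
    (hγ.differentiableOn (by simp)).differentiableAt (hG.mem_nhds hz)
  have dφ' : ∀ z ∈ B, DifferentiableAt ℝ (fderiv ℝ φ) z := fun z hz =>
    ((hφ.fderiv_of_isOpen hB (m := ∞) (by simp)).differentiableOn (by simp)).differentiableAt
      (hB.mem_nhds hz)
  have hder : ∀ z ∈ B, HasFDerivAt (fun z => (γ (φ z)).comp (fderiv ℝ φ z)) _ z := fun z hz =>
    ((dγ _ (hφG hz)).hasFDerivAt.comp z (dφ z hz).hasFDerivAt).clm_comp (dφ' z hz).hasFDerivAt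
  -- The pulled-back form `φ^*γ` is closed: the term with the second derivative of `φ` is symmetric,
  -- and the other one is symmetric because `γ` is closed. Its primitive on `B` is carried back by
  -- `ψ`.
  obtain ⟨f, hf⟩ := hBc.exists_forall_hasFDerivAt_of_fderiv_symmetric hB
    (fun z hz => (hder z hz).differentiableAt.differentiableWithinAt :
      DifferentiableOn ℝ (fun z => (γ (φ z)).comp (fderiv ℝ φ z)) B) (by
      intro z hz v w
      rw [(hder z hz).fderiv]
      have hs : fderiv ℝ (fderiv ℝ φ) z v w = fderiv ℝ (fderiv ℝ φ) z w v :=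
        ((hφ.contDiffAt (hB.mem_nhds hz)).isSymmSndFDerivAt (by
          simpa using (mod_cast le_top : ((2 : ℕ∞) : WithTop ℕ∞) ≤ ∞))).eq _ _
      simp [hs, hsymm _ (hφG hz) (fderiv ℝ φ z v)])
  refine ⟨f ∘ ψ, fun x hx => ?_⟩
  have h1 := (hf (ψ x) (hψB hx)).comp x (dψ x hx).hasFDerivAt
  have h2 : (fderiv ℝ φ (ψ x)).comp (fderiv ℝ ψ x) = ContinuousLinearMap.id ℝ Plane := by
    have h3 := (dφ (ψ x) (hψB hx)).hasFDerivAt.comp x (dψ x hx).hasFDerivAt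
    refine h3.unique ((hasFDerivAt_id x).congr_of_eventuallyEq ?_)
    filter_upwards [hG.mem_nhds hx] with y hy using hinv y hy
  rwa [ContinuousLinearMap.comp_assoc, h2, hinv x hx, ContinuousLinearMap.comp_id] at h1

theorem apply_eq_sum_single (L : Plane →L[ℝ] ℝ) (v : Plane) :
    L v = v 0 * L (EuclideanSpace.single 0 1) + v 1 * L (EuclideanSpace.single 1 1) := by
  have : v = v 0 • EuclideanSpace.single 0 (1 : ℝ) + v 1 • EuclideanSpace.single 1 (1 : ℝ) := by
    ext i
    fin_cases i <;> simp
  conv_lhs => rw [this]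
  simp

theorem ContDiffOn.of_hasFDerivAt {f : Plane → ℝ} {γ : Plane → Plane →L[ℝ] ℝ} (hG : IsOpen G)
    (hγ : ContDiffOn ℝ ∞ γ G) (hf : ∀ x ∈ G, HasFDerivAt f (γ x) x) : ContDiffOn ℝ ∞ f G := by
  rw [contDiffOn_infty_iff_fderiv_of_isOpen hG]
  exact ⟨fun x hx => (hf x hx).differentiableAt.differentiableWithinAt,
    hγ.congr fun x hx => (hf x hx).fderiv⟩

/-- Closed smooth `1`-forms on a smooth disk are exact. -/
theorem IsSmoothDiskDomain.exists_primitive (hG : IsSmoothDiskDomain G) {a b : Plane → ℝ}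
    (ha : ContDiffOn ℝ ∞ a G) (hb : ContDiffOn ℝ ∞ b G)
    (hab : ∀ x ∈ G, partialD 0 b x = partialD 1 a x) :
    ∃ f : Plane → ℝ, ContDiffOn ℝ ∞ f G ∧ ∀ x ∈ G, partialD 0 f x = a x ∧ partialD 1 f x = b x := by
  obtain ⟨hGo, φ, ψ, hφ, hψ, hbij, hinv, himg⟩ := hG
  have hsub : Metric.ball (0 : Plane) 1 ⊆ Metric.closedBall 0 1 := Metric.ball_subset_closedBall
  have hmaps : Set.MapsTo φ (Metric.ball 0 1) G := fun z hz => himg ▸ Set.mem_image_of_mem φ hz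
  let p : Fin 2 → Plane →L[ℝ] ℝ := fun i => EuclideanSpace.proj i
  let γ : Plane → Plane →L[ℝ] ℝ := fun x => a x • p 0 + b x • p 1
  have hγ : ContDiffOn ℝ ∞ γ G := (ha.smul contDiffOn_const).add (hb.smul contDiffOn_const)
  obtain ⟨f, hf⟩ := exists_hasFDerivAt_of_diffeo (G := G) (γ := γ) Metric.isOpen_ball
    (convex_ball (0 : Plane) 1) hGo (hφ.mono hsub) (hψ.mono subset_closure) hmaps
    (by
      intro x hx
      obtain ⟨z, hz, rfl⟩ := himg.symm ▸ hx
      rwa [hinv.1 (hsub hz)])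
    (fun x hx => hinv.2 (subset_closure hx)) hγ (by
      intro x hx v w
      have da := ha.differentiableAt_of_isOpen hGo hx
      have db := hb.differentiableAt_of_isOpen hGo hx
      have h := ((da.hasFDerivAt.smul_const (p 0)).add (db.hasFDerivAt.smul_const (p 1))).fderiv
      have h' : fderiv ℝ γ x = _ := h
      rw [h']
      have key := hab x hx
      unfold partialD at key
      simp [p, apply_eq_sum_single (fderiv ℝ a x) v, apply_eq_sum_single (fderiv ℝ a x) w,
        apply_eq_sum_single (fderiv ℝ b x) v, apply_eq_sum_single (fderiv ℝ b x) w, key]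
      ring)
  refine ⟨f, ContDiffOn.of_hasFDerivAt hGo hγ hf, fun x hx => ⟨?_, ?_⟩⟩
  · rw [(hf x hx).partialD]; simp [γ, p]
  · rw [(hf x hx).partialD]; simp [γ, p]

end Poincare

/-! ### Developing map of a flat metric. -/

section Developing

/-- `F₁, F₂` are the components of a local isometry from `(G, g)` to the Euclidean plane which
preserves the orientation. -/
def IsDevelopingMap (G : Set Plane) (g : TensorField) (F₁ F₂ : Plane → ℝ) : Prop :=
  ContDiffOn ℝ ∞ F₁ G ∧ ContDiffOn ℝ ∞ F₂ G ∧ ∀ x ∈ G,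
    (∀ i j, g x i j = partialD i F₁ x * partialD j F₁ x + partialD i F₂ x * partialD j F₂ x) ∧
    partialD 0 F₁ x * partialD 1 F₂ x - partialD 1 F₁ x * partialD 0 F₂ x
      = Real.sqrt (g x).det

variable {G : Set Plane} {g : TensorField}

theorem partialD_mul_add_mul {a b c d : Plane → ℝ} {x : Plane} (k : Fin 2)
    (ha : DifferentiableAt ℝ a x) (hb : DifferentiableAt ℝ b x) (hc : DifferentiableAt ℝ c x)
    (hd : DifferentiableAt ℝ d x) :
    partialD k (fun y => a y * b y + c y * d y) x
      = a x * partialD k b x + b x * partialD k a x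
        + (c x * partialD k d x + d x * partialD k c x) := by
  rw [← partialD_mul ha hb, ← partialD_mul hc hd]
  exact partialD_add (ha.mul hb) (hc.mul hd)

/-- A flat metric on a smooth disk has a developing map, that is, a local isometry to the
Euclidean plane. -/
theorem IsSmoothDiskDomain.exists_developing (hG : IsSmoothDiskDomain G)
    (hg : IsRiemannianMetricOn g G) (hflat : IsFlatOn g G) :
    ∃ F₁ F₂ : Plane → ℝ, IsDevelopingMap G g F₁ F₂ := by
  have hGo := hG.1
  have hE : ∀ x ∈ G, g x 0 0 ≠ 0 := fun x hx => (hg.diag_pos hx 0).ne'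
  have hsE : ∀ x ∈ G, Real.sqrt (g x 0 0) ≠ 0 := fun x hx =>
    (Real.sqrt_pos.2 (hg.diag_pos hx 0)).ne'
  have hγ := hg.contDiffOn_connForm hGo
  -- Flatness makes the connection form closed, so it is `dα`. Rotating the Gram–Schmidt frame by
  -- the angle `α` makes it parallel.
  obtain ⟨α, hα, hdα⟩ := hG.exists_primitive (hγ 0) (hγ 1) (fun x hx => by
    have := hg.partialD_connForm hGo hx
    rw [hflat x hx, zero_mul] at this
    linarith)
  -- The coframe dual to the Gram–Schmidt frame: `e¹ = θ₀ dx₀ + θ₁ dx₁` and `e² = η dx₁`.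
  let θ₀ : Plane → ℝ := fun x => Real.sqrt (g x 0 0)
  let θ₁ : Plane → ℝ := fun x => g x 0 1 / Real.sqrt (g x 0 0)
  let η : Plane → ℝ := fun x => Real.sqrt (g x).det / Real.sqrt (g x 0 0)
  have cθ₀ : ContDiffOn ℝ ∞ θ₀ G := (hg.smooth 0 0).sqrt hE
  have cθ₁ : ContDiffOn ℝ ∞ θ₁ G := (hg.smooth 0 1).div cθ₀ hsE
  have cη : ContDiffOn ℝ ∞ η G := hg.contDiffOn_sqrt_det.div cθ₀ hsE
  have cc : ContDiffOn ℝ ∞ (fun x => Real.cos (α x)) G := hα.cos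
  have cs : ContDiffOn ℝ ∞ (fun x => Real.sin (α x)) G := hα.sin
  -- Cartan's structure equations `de¹ = ω ∧ e²` and `de² = -ω ∧ e¹` for the connection form `ω`.
  have hstruct : ∀ x ∈ G, partialD 0 θ₁ x - partialD 1 θ₀ x = connForm g 0 x * η x ∧
      partialD 0 η x = connForm g 1 x * θ₀ x - connForm g 0 x * θ₁ x := by
    intro x hx
    have dg : ∀ i j, DifferentiableAt ℝ (fun y => g y i j) x := fun i j =>
      (hg.smooth i j).differentiableAt_of_isOpen hGo hx
    have dD := hg.contDiffOn_det.differentiableAt_of_isOpen hGo hx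
    have dS := hg.contDiffOn_sqrt_det.differentiableAt_of_isOpen hGo hx
    have dE : DifferentiableAt ℝ θ₀ x := cθ₀.differentiableAt_of_isOpen hGo hx
    have hD := hg.det_pos hx
    have hpE := hg.diag_pos hx 0
    have hs : ∀ k, partialD k (fun y => g y 1 0) x = partialD k (fun y => g y 0 1) x := fun k =>
      partialD_congr (by filter_upwards [hGo.mem_nhds hx] with z hz using hg.symm hz)
    have hdet : partialD 0 (fun y => (g y).det) x
        = g x 0 0 * partialD 0 (fun y => g y 1 1) x + g x 1 1 * partialD 0 (fun y => g y 0 0) x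
          - 2 * (g x 0 1 * partialD 0 (fun y => g y 0 1) x) := by
      rw [partialD_congr (h := fun y => g y 0 0 * g y 1 1 - g y 0 1 * g y 0 1)
          (by filter_upwards [hGo.mem_nhds hx] with y hy using hg.det_eq hy),
        partialD_sub (f := fun y => g y 0 0 * g y 1 1) (h := fun y => g y 0 1 * g y 0 1)
          ((dg 0 0).mul (dg 1 1)) ((dg 0 1).mul (dg 0 1)),
        partialD_mul (dg 0 0) (dg 1 1), partialD_mul (dg 0 1) (dg 0 1)]
      ring
    have h1 : ∀ k, partialD k θ₀ x = partialD k (fun y => g y 0 0) x / (2 * Real.sqrt (g x 0 0)) :=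
      fun k => partialD_sqrt (dg 0 0) (hE x hx)
    have h2 : partialD 0 θ₁ x = _ := partialD_div (dg 0 1) dE (hsE x hx)
    have h3 : partialD 0 η x = _ := partialD_div dS dE (hsE x hx)
    rw [h2, h3, h1, h1, partialD_sqrt dD hD.ne', hdet]
    simp only [connForm, hg.christoffel_one hx, christoffelFirst, hs, η, θ₀, θ₁]
    have hsq : Real.sqrt (g x).det ^ 2 = (g x).det := Real.sq_sqrt hD.le
    have hS := Real.sqrt_pos.2 hD
    have hH : g x 1 1 = (Real.sqrt (g x).det ^ 2 + g x 0 1 * g x 0 1) / g x 0 0 := by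
      have := hg.det_eq hx
      field_simp
      linarith
    have hsqE : Real.sqrt (g x 0 0) ^ 2 = g x 0 0 := Real.sq_sqrt hpE.le
    have hR := Real.sqrt_pos.2 hpE
    rw [hH]
    generalize Real.sqrt (g x).det = S at *
    generalize (g x).det = D at *
    generalize Real.sqrt (g x 0 0) = R at *
    rw [← hsq, ← hsqE]
    constructor
    · field_simp
      ring
    · field_simp
      ring
  have hdcos : ∀ x ∈ G, ∀ k, partialD k (fun y => Real.cos (α y)) x
      = -Real.sin (α x) * partialD k α x := fun x hx k =>
    partialD_comp (Real.hasDerivAt_cos _) (hα.differentiableAt_of_isOpen hGo hx)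
  have hdsin : ∀ x ∈ G, ∀ k, partialD k (fun y => Real.sin (α y)) x
      = Real.cos (α x) * partialD k α x := fun x hx k =>
    partialD_comp (Real.hasDerivAt_sin _) (hα.differentiableAt_of_isOpen hGo hx)
  -- The rotated coframe `cos α e¹ - sin α e²`, `sin α e¹ + cos α e²` is closed by the structure
  -- equations and `dα = ω`; its primitives are the two components of the isometry.
  obtain ⟨F₁, cF₁, hF₁⟩ := hG.exists_primitive (a := fun x => Real.cos (α x) * θ₀ x)
    (b := fun x => Real.cos (α x) * θ₁ x + -Real.sin (α x) * η x) (cc.mul cθ₀)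
    ((cc.mul cθ₁).add (cs.neg.mul cη)) (by
      intro x hx
      have d := fun {f : Plane → ℝ} (hf : ContDiffOn ℝ ∞ f G) =>
        hf.differentiableAt_of_isOpen hGo hx
      have hneg : partialD 0 (fun y => -Real.sin (α y)) x
          = -(Real.cos (α x) * partialD 0 α x) := by
        rw [← hdsin x hx 0, (d cs.neg).hasFDerivAt.partialD]
        simp [partialD, fderiv_fun_neg]
      rw [partialD_mul_add_mul 0 (d cc) (d cθ₁) (d cs.neg) (d cη), partialD_mul (d cc) (d cθ₀),
        hneg, hdcos x hx, hdcos x hx, (hdα x hx).1, (hdα x hx).2]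
      linear_combination Real.cos (α x) * (hstruct x hx).1 - Real.sin (α x) * (hstruct x hx).2)
  obtain ⟨F₂, cF₂, hF₂⟩ := hG.exists_primitive (a := fun x => Real.sin (α x) * θ₀ x)
    (b := fun x => Real.sin (α x) * θ₁ x + Real.cos (α x) * η x) (cs.mul cθ₀)
    ((cs.mul cθ₁).add (cc.mul cη)) (by
      intro x hx
      have d := fun {f : Plane → ℝ} (hf : ContDiffOn ℝ ∞ f G) =>
        hf.differentiableAt_of_isOpen hGo hx
      rw [partialD_mul_add_mul 0 (d cs) (d cθ₁) (d cc) (d cη), partialD_mul (d cs) (d cθ₀),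
        hdcos x hx, hdsin x hx, hdsin x hx, (hdα x hx).1, (hdα x hx).2]
      linear_combination Real.sin (α x) * (hstruct x hx).1 + Real.cos (α x) * (hstruct x hx).2)
  refine ⟨F₁, F₂, cF₁, cF₂, fun x hx => ?_⟩
  have hD := hg.det_pos hx
  have hpE := hg.diag_pos hx 0
  have hsq : Real.sqrt (g x).det ^ 2 = (g x).det := Real.sq_sqrt hD.le
  have hS := Real.sqrt_pos.2 hD
  have hH : g x 1 1 = (Real.sqrt (g x).det ^ 2 + g x 0 1 * g x 0 1) / g x 0 0 := by
    have := hg.det_eq hx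
    field_simp
    linarith
  have hsqE : Real.sqrt (g x 0 0) ^ 2 = g x 0 0 := Real.sq_sqrt hpE.le
  have hR := Real.sqrt_pos.2 hpE
  have hcs := Real.sin_sq_add_cos_sq (α x)
  have hsymm := hg.symm hx
  have e00 : g x 0 0 = partialD 0 F₁ x * partialD 0 F₁ x + partialD 0 F₂ x * partialD 0 F₂ x := by
    rw [(hF₁ x hx).1, (hF₂ x hx).1]
    simp only [θ₀]
    linear_combination -Real.sqrt (g x 0 0) ^ 2 * hcs - hsqE
  have e01 : g x 0 1 = partialD 0 F₁ x * partialD 1 F₁ x + partialD 0 F₂ x * partialD 1 F₂ x := by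
    rw [(hF₁ x hx).1, (hF₁ x hx).2, (hF₂ x hx).1, (hF₂ x hx).2]
    simp only [θ₀, θ₁, η]
    field_simp
    linear_combination -g x 0 1 * hcs
  have e11 : g x 1 1 = partialD 1 F₁ x * partialD 1 F₁ x + partialD 1 F₂ x * partialD 1 F₂ x := by
    rw [(hF₁ x hx).2, (hF₂ x hx).2, hH]
    simp only [θ₁, η]
    field_simp
    rw [hsqE]
    field_simp
    linear_combination -(Real.sqrt (g x).det ^ 2 + g x 0 1 ^ 2) * hcs
  have e10 : g x 1 0 = partialD 1 F₁ x * partialD 0 F₁ x + partialD 1 F₂ x * partialD 0 F₂ x := by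
    rw [hsymm, e01]
    ring
  refine ⟨fun i j => ?_, ?_⟩
  · fin_cases i <;> fin_cases j
    · exact e00
    · exact e01
    · exact e10
    · exact e11
  · rw [(hF₁ x hx).1, (hF₁ x hx).2, (hF₂ x hx).1, (hF₂ x hx).2]
    simp only [θ₀, θ₁, η]
    field_simp
    linear_combination Real.sqrt (g x).det * hcs

end Developing

/-! ### Polar coordinates in the plane. -/

section Polar

/-- The unit vector of the plane with polar angle `θ`. -/
noncomputable def polarUnit (θ : ℝ) : Plane := !₂[Real.cos θ, Real.sin θ]

@[simp] theorem polarUnit_zero (θ : ℝ) : polarUnit θ 0 = Real.cos θ := rfl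

@[simp] theorem polarUnit_one (θ : ℝ) : polarUnit θ 1 = Real.sin θ := rfl

theorem continuous_polarUnit : Continuous polarUnit := by
  unfold polarUnit
  refine (PiLp.continuous_toLp 2 _).comp (continuous_pi fun i => ?_)
  fin_cases i
  · exact Real.continuous_cos
  · exact Real.continuous_sin

theorem norm_sq_plane (v : Plane) : ‖v‖ ^ 2 = v 0 ^ 2 + v 1 ^ 2 := by
  rw [EuclideanSpace.norm_sq_eq, Fin.sum_univ_two, Real.norm_eq_abs, Real.norm_eq_abs, sq_abs,
    sq_abs]

@[simp] theorem norm_polarUnit (θ : ℝ) : ‖polarUnit θ‖ = 1 := by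
  have h := norm_sq_plane (polarUnit θ)
  rw [polarUnit_zero, polarUnit_one, Real.cos_sq_add_sin_sq] at h
  exact (pow_eq_one_iff_of_nonneg (norm_nonneg _) two_ne_zero).1 h

/-- The polar formula for `ℂ`, transported by the isometry given by the basis `1, i`. -/
theorem integral_plane_polar (f : Plane → ℝ) :
    ∫ y, f y = ∫ p in polarCoord.target, p.1 * f (p.1 • polarUnit p.2) := by
  rw [← (Complex.orthonormalBasisOneI.repr.measurePreserving).integral_comp
      Complex.orthonormalBasisOneI.repr.toMeasurableEquiv.measurableEmbedding,
    ← Complex.integral_comp_polarCoord_symm]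
  refine integral_congr_ae (Eventually.of_forall fun p => ?_)
  have : Complex.orthonormalBasisOneI.repr (Complex.polarCoord.symm p)
      = p.1 • polarUnit p.2 := by
    ext i
    rw [Complex.polarCoord_symm_apply]
    fin_cases i <;> simp [Complex.cos_ofReal_re, Complex.sin_ofReal_re]
  simp only [this, smul_eq_mul]

theorem integrableOn_polarTarget {Φ : ℝ × ℝ → ℝ} (hΦ : Continuous Φ) {R : ℝ}
    (hR : ∀ r θ, R < r → Φ (r, θ) = 0) : IntegrableOn Φ polarCoord.target := by
  have hK : IsCompact (Set.Icc 0 R ×ˢ Set.Icc (-Real.pi) Real.pi) := isCompact_Icc.prod isCompact_Icc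
  refine (hΦ.continuousOn.integrableOn_compact hK).of_forall_sdiff_eq_zero
    polarCoord.open_target.measurableSet ?_
  rintro ⟨r, θ⟩ ⟨⟨hr, hθ⟩, hn⟩
  refine hR r θ (lt_of_not_ge fun hle => hn ⟨⟨le_of_lt hr, hle⟩, ⟨hθ.1.le, hθ.2.le⟩⟩)

theorem integral_polarTarget {Φ : ℝ × ℝ → ℝ} (hΦ : Continuous Φ) {R : ℝ}
    (hR : ∀ r θ, R < r → Φ (r, θ) = 0) :
    ∫ p in polarCoord.target, Φ p
      = ∫ θ in Set.Ioo (-Real.pi) Real.pi, ∫ r in Set.Ioi 0, Φ (r, θ) := by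
  have hi := integrableOn_polarTarget hΦ hR
  rw [polarCoord_target, Measure.volume_eq_prod] at *
  rw [IntegrableOn, ← Measure.prod_restrict] at hi
  rw [← Measure.prod_restrict, integral_prod_symm _ hi]

end Polar

/-! ### One-dimensional integrals for the sharp bound on the Newtonian field. -/

section Bathtub

/-- The area of a right triangle with legs `α⁺` and `α⁺ / c`. -/
theorem integral_Ioi_max_sub {c : ℝ} (hc : 0 < c) (α : ℝ) :
    ∫ r in Set.Ioi (0:ℝ), max (α - c * r) 0 = max α 0 ^ 2 / (2 * c) := by
  have hb : 0 ≤ max α 0 / c := div_nonneg (le_max_right _ _) hc.le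
  have h1 : ∫ r in Set.Ioi (0:ℝ), max (α - c * r) 0
      = ∫ r in Set.Ioc (0:ℝ) (max α 0 / c), (max α 0 - c * r) := by
    refine (setIntegral_eq_of_subset_of_forall_sdiff_eq_zero measurableSet_Ioi
      (Set.Ioc_subset_Ioi_self : Set.Ioc 0 (max α 0 / c) ⊆ Set.Ioi 0) fun r hr => ?_).trans
      (setIntegral_congr_fun measurableSet_Ioc fun r hr => ?_)
    · have h2 : max α 0 / c < r := lt_of_not_ge fun h => hr.2 ⟨hr.1, h⟩
      have h3 : max α 0 < r * c := (div_lt_iff₀ hc).1 h2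
      exact max_eq_right (by linarith [le_max_left α 0])
    · have h2 : r * c ≤ max α 0 := (le_div_iff₀ hc).1 hr.2
      have h3 : 0 < r * c := mul_pos hr.1 hc
      have h4 : 0 < α := by
        by_contra h
        rw [max_eq_right (not_lt.1 h)] at h2
        linarith
      rw [max_eq_left h4.le] at h2 ⊢
      exact max_eq_left (by linarith)
  rw [h1, ← intervalIntegral.integral_of_le hb, intervalIntegral.integral_sub (by simp)
    (Continuous.intervalIntegrable (by fun_prop) _ _),
    intervalIntegral.integral_const, intervalIntegral.integral_const_mul, integral_id]
  simp only [smul_eq_mul]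
  field_simp
  ring

/-- The shift `θ ↦ θ + π` exchanges positive and negative parts, so the integral is half of that of
`(a cos θ + b sin θ)²` over a full period. -/
theorem integral_max_cos_sin_sq (a b : ℝ) :
    ∫ θ in Set.Ioo (-Real.pi) Real.pi, max (a * Real.cos θ + b * Real.sin θ) 0 ^ 2
      = Real.pi / 2 * (a ^ 2 + b ^ 2) := by
  have hpi := Real.pi_pos
  set f : ℝ → ℝ := fun θ => a * Real.cos θ + b * Real.sin θ with hf
  have cf : Continuous f := by fun_prop
  have cm : Continuous fun θ => max (f θ) 0 ^ 2 := (cf.max continuous_const).pow 2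
  have cm' : Continuous fun θ => max (-f θ) 0 ^ 2 := (cf.neg.max continuous_const).pow 2
  rw [← integral_Ioc_eq_integral_Ioo, ← intervalIntegral.integral_of_le (by linarith),
    ← intervalIntegral.integral_add_adjacent_intervals (b := 0) (cm.intervalIntegrable _ _)
      (cm.intervalIntegrable _ _)]
  have h1 : ∫ θ in (0:ℝ)..Real.pi, max (f θ) 0 ^ 2 = ∫ θ in (-Real.pi)..0, max (-f θ) 0 ^ 2 := by
    have := intervalIntegral.integral_comp_add_right (a := -Real.pi) (b := 0)
      (fun θ => max (f θ) 0 ^ 2) Real.pi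
    rw [neg_add_cancel, zero_add] at this
    rw [← this]
    refine intervalIntegral.integral_congr fun θ _ => ?_
    simp only [hf, Real.cos_add_pi, Real.sin_add_pi]
    congr 2
    ring
  have h2 : ∀ θ, max (f θ) 0 ^ 2 + max (-f θ) 0 ^ 2 = f θ ^ 2 := fun θ => by
    rcases le_total 0 (f θ) with h | h
    · rw [max_eq_left h, max_eq_right (by linarith)]; ring
    · rw [max_eq_right h, max_eq_left (by linarith)]; ring
  have h3 : ∀ θ, f θ ^ 2 = a ^ 2 * Real.cos θ ^ 2 + b ^ 2 * Real.sin θ ^ 2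
      + 2 * a * b * (Real.sin θ * Real.cos θ) := fun θ => by simp only [hf]; ring
  have h4 : ∀ g : ℝ → ℝ, Continuous g → IntervalIntegrable g volume (-Real.pi) 0 := fun g hg =>
    hg.intervalIntegrable _ _
  rw [h1, ← intervalIntegral.integral_add (h4 _ cm) (h4 _ cm')]
  simp only [h2, h3]
  rw [intervalIntegral.integral_add (h4 _ (by fun_prop)) (h4 _ (by fun_prop)),
    intervalIntegral.integral_add (h4 _ (by fun_prop)) (h4 _ (by fun_prop)),
    intervalIntegral.integral_const_mul, intervalIntegral.integral_const_mul,
    intervalIntegral.integral_const_mul, integral_cos_sq, integral_sin_sq, integral_sin_mul_cos₁]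
  simp
  ring

end Bathtub

/-! ### The gradient of the Newtonian potential: divergence and sharp bound. -/

section Kernel

/-- The components of the gradient of the fundamental solution of the Laplace operator. -/
noncomputable def newtonKernel (i : Fin 2) (z : Plane) : ℝ := (2 * Real.pi)⁻¹ * (z i / ‖z‖ ^ 2)

/-- A singularity of order `|z|⁻¹` is integrable in dimension two, which makes all convolutions
below well defined. -/
theorem abs_newtonKernel_le (i : Fin 2) (z : Plane) :
    ‖newtonKernel i z‖ ≤ (2 * Real.pi)⁻¹ * ‖z‖ ^ (-1 : ℝ) := by
  have hpi := Real.pi_pos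
  have h := PiLp.norm_apply_le z i
  rw [newtonKernel, norm_mul, norm_div, norm_pow, norm_norm,
    Real.norm_of_nonneg (by positivity : (0:ℝ) ≤ (2 * Real.pi)⁻¹), Real.rpow_neg_one]
  refine mul_le_mul_of_nonneg_left ?_ (by positivity)
  rcases eq_or_ne z 0 with rfl | hz
  · simp
  · have := norm_pos_iff.2 hz
    rw [div_le_iff₀ (by positivity)]
    calc ‖z i‖ ≤ ‖z‖ := h
      _ = ‖z‖⁻¹ * ‖z‖ ^ 2 := by field_simp

theorem measurable_newtonKernel (i : Fin 2) : Measurable (newtonKernel i) := by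
  unfold newtonKernel
  have : Measurable fun z : Plane => z i := (EuclideanSpace.proj (𝕜 := ℝ) i).continuous.measurable
  fun_prop

theorem locallyIntegrable_newtonKernel (i : Fin 2) :
    LocallyIntegrable (newtonKernel i) (volume : Measure Plane) :=
  locallyIntegrable_of_norm_le_rpow (C := (2 * Real.pi)⁻¹) (α := 1) (by simp) (by simp)
    (Eventually.of_forall fun z => abs_newtonKernel_le i z)
    (measurable_newtonKernel i).aestronglyMeasurable

/-- The components of the gradient of the Newtonian potential of `h`. -/
noncomputable def newtonField (h : Plane → ℝ) (i : Fin 2) : Plane → ℝ :=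
  convolution (newtonKernel i) h (ContinuousLinearMap.lsmul ℝ ℝ) volume

theorem newtonField_apply (h : Plane → ℝ) (i : Fin 2) (y : Plane) :
    newtonField h i y = ∫ t, newtonKernel i t * h (y - t) := rfl

variable {h : Plane → ℝ}

theorem integrable_newtonKernel_mul (i : Fin 2) (hh : Continuous h) (hc : HasCompactSupport h)
    (y : Plane) : Integrable fun t => newtonKernel i t * h (y - t) :=
  (hc.convolutionExists_right (ContinuousLinearMap.lsmul ℝ ℝ)
    (locallyIntegrable_newtonKernel i) hh) y

theorem contDiff_newtonField (hh : ContDiff ℝ ∞ h) (hc : HasCompactSupport h) (i : Fin 2) :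
    ContDiff ℝ ∞ (newtonField h i) :=
  hc.contDiff_convolution_right _ (locallyIntegrable_newtonKernel i) hh

theorem partialD_newtonField (hh : ContDiff ℝ ∞ h) (hc : HasCompactSupport h) (i k : Fin 2)
    (y : Plane) :
    partialD k (newtonField h i) y = ∫ t, newtonKernel i t * partialD k h (y - t) := by
  have h1 : ContDiff ℝ 1 h := hh.of_le (by simp)
  have := (hc.hasFDerivAt_convolution_right (ContinuousLinearMap.lsmul ℝ ℝ)
    (locallyIntegrable_newtonKernel i) h1 y).partialD (k := k)
  unfold newtonField
  rw [this, convolution_precompR_apply _ (locallyIntegrable_newtonKernel i) (hc.fderiv ℝ)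
    (h1.continuous_fderiv one_ne_zero)]
  rfl

theorem exists_forall_eq_zero_of_hasCompactSupport {E : Type*} [NormedAddCommGroup E]
    {h : Plane → E} (hc : HasCompactSupport h) (y : Plane) :
    ∃ R : ℝ, ∀ z : Plane, R < ‖z‖ → h (y - z) = 0 := by
  obtain ⟨C, hC⟩ := hc.isCompact.isBounded.exists_norm_le
  refine ⟨‖y‖ + C, fun z hz => ?_⟩
  by_contra hne
  have h1 := hC _ (subset_tsupport _ hne)
  have h2 : ‖z‖ ≤ ‖y‖ + ‖y - z‖ := by
    calc ‖z‖ = ‖y - (y - z)‖ := by rw [sub_sub_cancel]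
      _ ≤ _ := norm_sub_le _ _
  linarith

/-- In polar coordinates around `y` the Jacobian `r` cancels the kernel's singularity and leaves
`1/2π` times the radial derivative of `h`. Each ray thus contributes `h y / 2π`. -/
theorem newtonField_div (hh : ContDiff ℝ ∞ h) (hc : HasCompactSupport h) (y : Plane) :
    partialD 0 (newtonField h 0) y + partialD 1 (newtonField h 1) y = h y := by
  have hpi := Real.pi_pos
  have h1 : ContDiff ℝ 1 h := hh.of_le (by simp)
  have cD : Continuous (fderiv ℝ h) := h1.continuous_fderiv one_ne_zero
  have cP : ∀ k, Continuous (partialD k h) := fun k => cD.clm_apply continuous_const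
  have hcP : ∀ k, HasCompactSupport (partialD k h) := fun k => hc.fderiv_apply ℝ _
  rw [partialD_newtonField hh hc, partialD_newtonField hh hc,
    ← integral_add (integrable_newtonKernel_mul 0 (cP 0) (hcP 0) y)
      (integrable_newtonKernel_mul 1 (cP 1) (hcP 1) y), integral_plane_polar]
  obtain ⟨R, hR⟩ := exists_forall_eq_zero_of_hasCompactSupport hc y
  obtain ⟨R', hR'⟩ := exists_forall_eq_zero_of_hasCompactSupport (hc.fderiv ℝ) y
  let Φ : ℝ × ℝ → ℝ := fun p =>
    (2 * Real.pi)⁻¹ * fderiv ℝ h (y - p.1 • polarUnit p.2) (polarUnit p.2)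
  have cΦ : Continuous Φ := by
    have := continuous_polarUnit
    refine continuous_const.mul (Continuous.clm_apply (cD.comp ?_) ?_) <;> fun_prop
  have hΦ : ∀ r θ, max R' 0 < r → Φ (r, θ) = 0 := by
    intro r θ hr
    have hr0 : 0 < r := lt_of_le_of_lt (le_max_right _ _) hr
    simp only [Φ]
    rw [hR' _ (by
      rw [norm_smul, norm_polarUnit, mul_one, Real.norm_of_nonneg hr0.le]
      exact lt_of_le_of_lt (le_max_left _ _) hr)]
    simp
  have e1 : ∫ p in polarCoord.target, p.1 * (newtonKernel 0 (p.1 • polarUnit p.2)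
        * partialD 0 h (y - p.1 • polarUnit p.2) + newtonKernel 1 (p.1 • polarUnit p.2)
        * partialD 1 h (y - p.1 • polarUnit p.2)) = ∫ p in polarCoord.target, Φ p := by
    refine setIntegral_congr_fun polarCoord.open_target.measurableSet fun p hp => ?_
    have hp0 : 0 < p.1 := hp.1
    simp only [Φ]
    rw [apply_eq_sum_single _ (polarUnit p.2)]
    simp only [newtonKernel, norm_smul, norm_polarUnit, Real.norm_of_nonneg hp0.le, partialD]
    simp
    field_simp
  rw [e1, integral_polarTarget cΦ hΦ]
  have e2 : ∀ θ, ∫ r in Set.Ioi (0:ℝ), Φ (r, θ) = (2 * Real.pi)⁻¹ * h y := by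
    intro θ
    have hd : ∀ r : ℝ, HasDerivAt (fun r : ℝ => -((2 * Real.pi)⁻¹ * h (y - r • polarUnit θ)))
        (Φ (r, θ)) r := by
      intro r
      have hline : HasDerivAt (fun r : ℝ => y - r • polarUnit θ) (-(polarUnit θ)) r := by
        simpa using ((hasDerivAt_id r).smul_const (polarUnit θ)).const_sub y
      have := (((h1.differentiable one_ne_zero).differentiableAt.hasFDerivAt.comp_hasDerivAt r
        hline).const_mul (2 * Real.pi)⁻¹).neg
      simpa [Φ] using! this
    have cθ : Continuous fun r => Φ (r, θ) := cΦ.comp (by fun_prop)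
    have hint : IntegrableOn (fun r => Φ (r, θ)) (Set.Ioi 0) :=
      (cθ.continuousOn.integrableOn_compact (isCompact_Icc (a := 0) (b := max R' 0))
        ).of_forall_sdiff_eq_zero measurableSet_Ioi fun r hr =>
          hΦ r θ (lt_of_not_ge fun hle => hr.2 ⟨le_of_lt hr.1, hle⟩)
    have hlim : Tendsto (fun r : ℝ => -((2 * Real.pi)⁻¹ * h (y - r • polarUnit θ))) atTop (𝓝 0) := by
      refine tendsto_const_nhds.congr' ?_
      filter_upwards [eventually_gt_atTop (max R 0)] with r hr
      have hr0 : 0 < r := lt_of_le_of_lt (le_max_right _ _) hr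
      rw [hR _ (by
        rw [norm_smul, norm_polarUnit, mul_one, Real.norm_of_nonneg hr0.le]
        exact lt_of_le_of_lt (le_max_left _ _) hr)]
      simp
    rw [integral_Ioi_of_hasDerivAt_of_tendsto (hd 0).continuousAt.continuousWithinAt
      (fun r _ => hd r) hint hlim]
    simp
  simp only [e2]
  rw [setIntegral_const]
  simp [Measure.real, Real.volume_Ioo]
  rw [ENNReal.toReal_ofReal (by linarith)]
  field_simp
  ring

/-- A bathtub argument. With `(a, b)` the field at `y` and `κ` the kernel in that direction, `a² +
b² = ∫ κ h`. For `0 ≤ h ≤ 1` and any `c > 0` this is at most `c ∫ h + ∫ (κ - c)⁺`, and the last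
integral is explicit in polar coordinates. The constant is sharp: it is the one of the isoperimetric
inequality. -/
theorem newtonField_bound (hh : ContDiff ℝ ∞ h) (hc : HasCompactSupport h) (h0 : ∀ y, 0 ≤ h y)
    (h1 : ∀ y, h y ≤ 1) (y : Plane) :
    4 * Real.pi * (newtonField h 0 y ^ 2 + newtonField h 1 y ^ 2) ≤ ∫ z, h z := by
  have hpi := Real.pi_pos
  set a := newtonField h 0 y with ha
  set b := newtonField h 1 y with hb
  let κ : Plane → ℝ := fun t => a * newtonKernel 0 t + b * newtonKernel 1 t
  have hκm : Measurable κ :=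
    ((measurable_newtonKernel 0).const_mul a).add ((measurable_newtonKernel 1).const_mul b)
  have i0 := (integrable_newtonKernel_mul 0 hh.continuous hc y).const_mul a
  have i1 := (integrable_newtonKernel_mul 1 hh.continuous hc y).const_mul b
  have hsum : a ^ 2 + b ^ 2 = ∫ t, κ t * h (y - t) := by
    have e : ∀ t, κ t * h (y - t)
        = a * (newtonKernel 0 t * h (y - t)) + b * (newtonKernel 1 t * h (y - t)) := fun t => by
      simp only [κ]; ring
    simp only [e]
    rw [integral_add i0 i1, integral_const_mul, integral_const_mul, ← newtonField_apply,
      ← newtonField_apply]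
    ring
  have hκi : Integrable fun t => κ t * h (y - t) := by
    refine (i0.add i1).congr (Eventually.of_forall fun t => ?_)
    simp only [κ, Pi.add_apply]; ring
  -- The optimal threshold: it makes `∫ (κ - c)⁺` equal to `(a² + b²) / 2`, so that half of the left
  -- side is absorbed.
  let c : ℝ := (8 * Real.pi)⁻¹
  have hcpos : 0 < c := by positivity
  let P : Plane → ℝ := fun t => max (κ t - c) 0
  let Φ : ℝ × ℝ → ℝ := fun p =>
    (2 * Real.pi)⁻¹ * max ((a * Real.cos p.2 + b * Real.sin p.2) - 1 / 4 * p.1) 0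
  have cΦ : Continuous Φ := by fun_prop
  have hκP : ∀ (r θ : ℝ), 0 < r → κ (r • polarUnit θ)
      = (2 * Real.pi)⁻¹ * ((a * Real.cos θ + b * Real.sin θ) / r) := by
    intro r θ hr
    simp only [κ, newtonKernel, norm_smul, norm_polarUnit, Real.norm_of_nonneg hr.le]
    simp
    field_simp
  have hΦP : ∀ p ∈ polarCoord.target, p.1 * P (p.1 • polarUnit p.2) = Φ p := by
    rintro ⟨r, θ⟩ hp
    have hr : 0 < r := hp.1
    simp only [P, Φ, hκP r θ hr, c]
    rw [mul_max_of_nonneg _ _ hr.le, mul_max_of_nonneg _ _ (by positivity : (0:ℝ) ≤ (2 * Real.pi)⁻¹)]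
    congr 1
    · field_simp
      ring
    · simp
  -- Beyond the radius `4 (|a| + |b|)` the kernel lies below the threshold, so `(κ - c)⁺` has
  -- bounded support.
  have hΦ0 : ∀ r θ, 4 * (|a| + |b|) < r → Φ (r, θ) = 0 := by
    intro r θ hr
    have h2 : a * Real.cos θ ≤ |a| := by
      calc a * Real.cos θ ≤ |a * Real.cos θ| := le_abs_self _
        _ = |a| * |Real.cos θ| := abs_mul _ _
        _ ≤ |a| := mul_le_of_le_one_right (abs_nonneg _) (Real.abs_cos_le_one _)
    have h3 : b * Real.sin θ ≤ |b| := by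
      calc b * Real.sin θ ≤ |b * Real.sin θ| := le_abs_self _
        _ = |b| * |Real.sin θ| := abs_mul _ _
        _ ≤ |b| := mul_le_of_le_one_right (abs_nonneg _) (Real.abs_sin_le_one _)
    simp only [Φ]
    rw [max_eq_right (by linarith), mul_zero]
  have hPint : ∫ t, P t = (a ^ 2 + b ^ 2) / 2 := by
    rw [integral_plane_polar, setIntegral_congr_fun polarCoord.open_target.measurableSet hΦP,
      integral_polarTarget cΦ hΦ0]
    simp only [Φ]
    simp only [integral_const_mul, integral_Ioi_max_sub (by norm_num : (0:ℝ) < 1 / 4),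
      integral_div, integral_max_cos_sin_sq]
    field_simp
    ring
  have hPi : Integrable P := by
    have hl : LocallyIntegrable κ :=
      ((locallyIntegrable_newtonKernel 0).smul a).add ((locallyIntegrable_newtonKernel 1).smul b)
    have hb : IntegrableOn (fun t => ‖κ t‖) (Metric.closedBall 0 (4 * (|a| + |b|))) :=
      (hl.integrableOn_isCompact (isCompact_closedBall _ _)).norm
    have hPb : IntegrableOn P (Metric.closedBall 0 (4 * (|a| + |b|))) := by
      refine Integrable.mono' hb ((hκm.sub_const c).max measurable_const).aestronglyMeasurable
        (Eventually.of_forall fun t => ?_)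
      rw [Real.norm_of_nonneg (le_max_right _ _)]
      exact max_le ((sub_le_self _ hcpos.le).trans (le_abs_self _)) (norm_nonneg _)
    refine (integrableOn_iff_integrable_of_support_subset fun t ht => ?_).1 hPb
    by_contra hn
    rw [mem_closedBall_zero_iff, not_le] at hn
    refine ht (max_eq_right ?_)
    have hpos : 0 < ‖t‖ := lt_of_le_of_lt (by positivity) hn
    have k0 := abs_newtonKernel_le 0 t
    have k1 := abs_newtonKernel_le 1 t
    rw [Real.rpow_neg_one, Real.norm_eq_abs] at k0 k1
    have h2 : κ t ≤ (|a| + |b|) * ((2 * Real.pi)⁻¹ * ‖t‖⁻¹) := by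
      calc κ t ≤ |κ t| := le_abs_self _
        _ ≤ |a * newtonKernel 0 t| + |b * newtonKernel 1 t| := abs_add_le _ _
        _ = |a| * |newtonKernel 0 t| + |b| * |newtonKernel 1 t| := by rw [abs_mul, abs_mul]
        _ ≤ |a| * ((2 * Real.pi)⁻¹ * ‖t‖⁻¹) + |b| * ((2 * Real.pi)⁻¹ * ‖t‖⁻¹) :=
          add_le_add (mul_le_mul_of_nonneg_left k0 (abs_nonneg _))
            (mul_le_mul_of_nonneg_left k1 (abs_nonneg _))
        _ = _ := by ring
    have h3 : (|a| + |b|) * ((2 * Real.pi)⁻¹ * ‖t‖⁻¹) ≤ c := by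
      simp only [c]
      field_simp
      linarith
    linarith
  have hhi : Integrable fun t => h (y - t) :=
    (hh.continuous.integrable_of_hasCompactSupport hc).comp_sub_left y
  have hle : ∫ t, κ t * h (y - t) ≤ ∫ t, (c * h (y - t) + P t) := by
    refine integral_mono hκi ((hhi.const_mul c).add hPi) fun t => ?_
    have e1 := h0 (y - t)
    have e2 := h1 (y - t)
    have e3 : κ t - c ≤ P t := le_max_left _ _
    have e4 : 0 ≤ P t := le_max_right _ _
    have e5 : (κ t - c) * h (y - t) ≤ P t * h (y - t) := mul_le_mul_of_nonneg_right e3 e1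
    have e6 : P t * h (y - t) ≤ P t := mul_le_of_le_one_right e4 e2
    show κ t * h (y - t) ≤ c * h (y - t) + P t
    linarith
  rw [integral_add (hhi.const_mul c) hPi, integral_const_mul, integral_sub_left_eq_self h volume y,
    hPint, ← hsum] at hle
  simp only [c] at hle
  have : (a ^ 2 + b ^ 2) / 2 ≤ (8 * Real.pi)⁻¹ * ∫ t, h t := by linarith
  rw [inv_mul_eq_div, le_div_iff₀ (by positivity)] at this
  linarith

end Kernel

/-! ### Integration by parts, Cauchy–Schwarz and cutoffs. -/

section CompactSupport

variable {G K : Set Plane} {f : Plane → ℝ}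

theorem integrableOn_of_eq_zero_off_compact (hG : IsOpen G) (hK : IsCompact K) (hKG : K ⊆ G)
    (hf : ContinuousOn f G) (h0 : ∀ x ∈ G, x ∉ K → f x = 0) : IntegrableOn f G :=
  ((hf.mono hKG).integrableOn_compact hK).of_forall_sdiff_eq_zero hG.measurableSet
    fun x hx => h0 x hx.1 hx.2

/-- The divergence theorem without boundary term: extended by zero outside `G`, the function is `C¹`
with compact support on the plane, and integration by parts against the constant `1` applies. -/
theorem integral_partialD_eq_zero (hG : IsOpen G) (hK : IsCompact K) (hKG : K ⊆ G)
    (hf : ContDiffOn ℝ 1 f G) (h0 : ∀ x ∈ G, x ∉ K → f x = 0) (k : Fin 2) :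
    ∫ x in G, partialD k f x = 0 := by
  have hin : ∀ x ∈ G, G.indicator f =ᶠ[𝓝 x] f := fun x hx => by
    filter_upwards [hG.mem_nhds hx] with y hy using Set.indicator_of_mem hy f
  have hout : ∀ x ∉ K, G.indicator f =ᶠ[𝓝 x] fun _ => 0 := fun x hx => by
    filter_upwards [hK.isClosed.isOpen_compl.mem_nhds hx] with y hy
    by_cases hyG : y ∈ G
    · rw [Set.indicator_of_mem hyG, h0 y hyG hy]
    · rw [Set.indicator_of_notMem hyG]
  have hcd : ContDiff ℝ 1 (G.indicator f) := by
    rw [contDiff_iff_contDiffAt]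
    intro x
    by_cases hx : x ∈ K
    · exact (hf.contDiffAt (hG.mem_nhds (hKG hx))).congr_of_eventuallyEq (hin x (hKG hx))
    · exact contDiffAt_const.congr_of_eventuallyEq (hout x hx)
  have hcs : HasCompactSupport (G.indicator f) :=
    HasCompactSupport.intro hK fun x hx => (hout x hx).eq_of_nhds
  have hpc : Continuous (partialD k (G.indicator f)) :=
    (hcd.continuous_fderiv one_ne_zero).clm_apply continuous_const
  have hps : HasCompactSupport (partialD k (G.indicator f)) := hcs.fderiv_apply ℝ _
  have hibp := integral_mul_fderiv_eq_neg_fderiv_mul_of_integrable (μ := (volume : Measure Plane))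
    (f := fun _ : Plane => (1 : ℝ)) (g := G.indicator f) (v := EuclideanSpace.single k (1 : ℝ))
    (by simp) (by simpa using! hpc.integrable_of_hasCompactSupport hps)
    (by simpa using hcd.continuous.integrable_of_hasCompactSupport hcs)
    (fun x _ => differentiableAt_const _) (fun x _ => hcd.differentiable one_ne_zero x)
  simp only [fderiv_const_apply, one_mul, zero_apply, zero_mul, integral_zero, neg_zero] at hibp
  rw [← hibp]
  refine Eq.trans ?_ (setIntegral_eq_integral_of_forall_compl_eq_zero (s := G) ?_)
  · exact setIntegral_congr_fun hG.measurableSet fun x hx => (partialD_congr (hin x hx)).symm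
  · intro x hx
    have : partialD k (G.indicator f) x = 0 := by
      rw [partialD_congr (hout x fun hxK => hx (hKG hxK))]
      simp [partialD]
    exact this

/-- The quadratic polynomial `l ↦ ∫ (l √a - √b)²` is nonnegative, so its discriminant is not
positive. -/
theorem sq_integral_sqrt_mul_le {α : Type*} [MeasurableSpace α] {μ : Measure α} {a b : α → ℝ}
    (ha : Integrable a μ) (hb : Integrable b μ) (hab : Integrable (fun x => Real.sqrt (a x * b x)) μ)
    (ha0 : ∀ᵐ x ∂μ, 0 ≤ a x) (hb0 : ∀ᵐ x ∂μ, 0 ≤ b x) :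
    (∫ x, Real.sqrt (a x * b x) ∂μ) ^ 2 ≤ (∫ x, a x ∂μ) * ∫ x, b x ∂μ := by
  have key : ∀ l : ℝ, 0 ≤ (∫ x, a x ∂μ) * (l * l)
      + (-2 * ∫ x, Real.sqrt (a x * b x) ∂μ) * l + ∫ x, b x ∂μ := by
    intro l
    have : 0 ≤ ∫ x, (l * l * a x + (-2 * l) * Real.sqrt (a x * b x) + b x) ∂μ := by
      refine integral_nonneg_of_ae ?_
      filter_upwards [ha0, hb0] with x h1 h2
      have h3 : 0 ≤ (l * Real.sqrt (a x) - Real.sqrt (b x)) ^ 2 := sq_nonneg _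
      have h4 := Real.sq_sqrt h1
      have h5 := Real.sq_sqrt h2
      rw [Real.sqrt_mul h1]
      show 0 ≤ l * l * a x + (-2 * l) * (Real.sqrt (a x) * Real.sqrt (b x)) + b x
      calc (0:ℝ) ≤ _ := h3
        _ = _ := by linear_combination l ^ 2 * h4 + h5
    rw [integral_add (f := fun x => l * l * a x + (-2 * l) * Real.sqrt (a x * b x))
        ((ha.const_mul _).add (hab.const_mul _)) hb,
      integral_add (ha.const_mul _) (hab.const_mul _), integral_const_mul,
      integral_const_mul] at this
    linarith
  have := discrim_le_zero key
  unfold discrim at this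
  linarith

/-- A compact set admits smooth compactly supported majorants of its indicator function whose
integral is close to its area. -/
theorem exists_smooth_cutoff {S : Set Plane} (hS : IsCompact S) {δ : ℝ} (hδ : 0 < δ) :
    ∃ h : Plane → ℝ, ContDiff ℝ ∞ h ∧ HasCompactSupport h ∧ (∀ y, 0 ≤ h y) ∧ (∀ y, h y ≤ 1) ∧
      (∀ y ∈ S, h y = 1) ∧ ∫ y, h y ≤ volume.real S + δ := by
  obtain ⟨U, hSU, hU, hUδ⟩ := S.exists_isOpen_lt_of_lt
    (μ := volume) (volume S + ENNReal.ofReal δ)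
    (ENNReal.lt_add_right hS.measure_lt_top.ne (ENNReal.ofReal_pos.2 hδ).ne')
  obtain ⟨R, hR⟩ := hS.isBounded.subset_ball 0
  obtain ⟨h, hsm, hrange, hsupp, hone⟩ := exists_contMDiff_support_eq_eq_one_iff
    (n := ⊤) (modelWithCornersSelf ℝ Plane) (hU.inter Metric.isOpen_ball) hS.isClosed
    (Set.subset_inter hSU hR)
  have h01 : ∀ y, h y ∈ Set.Icc (0:ℝ) 1 := fun y => hrange (Set.mem_range_self y)
  have hcs : HasCompactSupport h := by
    refine HasCompactSupport.intro (isCompact_closedBall (0 : Plane) R) fun y hy => ?_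
    by_contra hne
    have : y ∈ Function.support h := hne
    rw [hsupp] at this
    exact hy (Metric.ball_subset_closedBall this.2)
  have hcd : ContDiff ℝ ∞ h := contMDiff_iff_contDiff.1 hsm
  have hUfin : volume U ≠ ⊤ := (hUδ.trans_le le_top).ne
  refine ⟨h, hcd, hcs, fun y => (h01 y).1, fun y => (h01 y).2, fun y hy => (hone y).1 hy, ?_⟩
  calc ∫ y, h y ≤ ∫ y, U.indicator (fun _ => (1:ℝ)) y := by
        refine integral_mono (hcd.continuous.integrable_of_hasCompactSupport hcs)
          ((integrable_indicator_iff hU.measurableSet).2 (integrableOn_const hUfin)) fun y => ?_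
        by_cases hy : y ∈ U
        · rw [Set.indicator_of_mem hy]
          exact (h01 y).2
        · rw [Set.indicator_of_notMem hy]
          refine (not_ne_iff.1 fun hne : h y ≠ 0 => hy ?_).le
          have : y ∈ Function.support h := hne
          rw [hsupp] at this
          exact this.1
    _ = volume.real U := by
        rw [integral_indicator hU.measurableSet, setIntegral_const]
        simp
    _ ≤ (volume S + ENNReal.ofReal δ).toReal :=
        ENNReal.toReal_mono (by simp [hS.measure_lt_top.ne]) hUδ.le
    _ = _ := by
        rw [ENNReal.toReal_add hS.measure_lt_top.ne (by simp), ENNReal.toReal_ofReal hδ.le]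
        rfl

end CompactSupport

/-! ### Truncations between two levels. -/

section Trapezoid

/-- A continuous function with values in `[0, 1]` supported in `[t, s]` which equals `1` on
`[t + δ, s - δ]`. -/
noncomputable def trapezoid (t s δ r : ℝ) : ℝ := max 0 (min 1 (min (r - t) (s - r) / δ))

theorem continuous_trapezoid (t s δ : ℝ) : Continuous (trapezoid t s δ) := by
  unfold trapezoid
  fun_prop

theorem trapezoid_nonneg (t s δ r : ℝ) : 0 ≤ trapezoid t s δ r := le_max_left _ _

theorem trapezoid_le_one (t s δ r : ℝ) : trapezoid t s δ r ≤ 1 :=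
  max_le zero_le_one (min_le_left _ _)

theorem trapezoid_eq_zero {t s δ r : ℝ} (hδ : 0 < δ) (h : r ≤ t ∨ s ≤ r) :
    trapezoid t s δ r = 0 := by
  refine max_eq_left ((min_le_right _ _).trans (div_nonpos_of_nonpos_of_nonneg ?_ hδ.le))
  rcases h with h | h
  · exact (min_le_left _ _).trans (by linarith)
  · exact (min_le_right _ _).trans (by linarith)

theorem trapezoid_eq_one {t s δ r : ℝ} (hδ : 0 < δ) (h₁ : t + δ ≤ r) (h₂ : r ≤ s - δ) :
    trapezoid t s δ r = 1 := by
  have : 1 ≤ min (r - t) (s - r) / δ := by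
    rw [le_div_iff₀ hδ, one_mul]
    exact le_min (by linarith) (by linarith)
  rw [trapezoid, min_eq_left this, max_eq_right zero_le_one]

/-- The primitive of `trapezoid` vanishing at `t`. -/
noncomputable def ramp (t s δ r : ℝ) : ℝ := ∫ v in t..r, trapezoid t s δ v

theorem hasDerivAt_ramp (t s δ r : ℝ) : HasDerivAt (ramp t s δ) (trapezoid t s δ r) r :=
  (continuous_trapezoid t s δ).integral_hasStrictDerivAt t r |>.hasDerivAt

theorem contDiff_ramp (t s δ : ℝ) : ContDiff ℝ 1 (ramp t s δ) := by
  rw [contDiff_one_iff_deriv]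
  refine ⟨fun r => (hasDerivAt_ramp t s δ r).differentiableAt, ?_⟩
  rw [funext fun r => (hasDerivAt_ramp t s δ r).deriv]
  exact continuous_trapezoid t s δ

theorem monotone_ramp (t s δ : ℝ) : Monotone (ramp t s δ) :=
  monotone_of_hasDerivAt_nonneg (fun r => hasDerivAt_ramp t s δ r)
    fun r => trapezoid_nonneg t s δ r

theorem ramp_of_le {t s δ r : ℝ} (hδ : 0 < δ) (h : r ≤ t) : ramp t s δ r = 0 := by
  unfold ramp
  rw [intervalIntegral.integral_symm, neg_eq_zero]
  refine intervalIntegral.integral_zero_ae (Eventually.of_forall fun v hv => ?_)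
  rw [Set.uIoc_of_le h] at hv
  exact trapezoid_eq_zero hδ (Or.inl hv.2)

theorem ramp_nonneg {t s δ : ℝ} (hδ : 0 < δ) (r : ℝ) : 0 ≤ ramp t s δ r := by
  rcases le_total r t with h | h
  · exact (ramp_of_le hδ h).ge
  · exact (ramp_of_le hδ le_rfl).ge.trans (monotone_ramp t s δ h)

theorem ramp_le {t s δ : ℝ} (hδ : 0 < δ) (r : ℝ) : ramp t s δ r ≤ ramp t s δ s := by
  rcases le_total r s with h | h
  · exact monotone_ramp t s δ h
  · have hi : ∀ a b, IntervalIntegrable (trapezoid t s δ) volume a b := fun a b =>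
      (continuous_trapezoid t s δ).intervalIntegrable a b
    have : ∫ v in s..r, trapezoid t s δ v = 0 := by
      refine intervalIntegral.integral_zero_ae (Eventually.of_forall fun v hv => ?_)
      rw [Set.uIoc_of_le h] at hv
      exact trapezoid_eq_zero hδ (Or.inr hv.1.le)
    unfold ramp
    rw [← intervalIntegral.integral_add_adjacent_intervals (hi t s) (hi s r), this, add_zero]

/-- The total rise of the truncation is `s - t` up to `2δ`, an error that vanishes as `δ → 0`. -/
theorem le_ramp {t s δ : ℝ} (hδ : 0 < δ) (h : 2 * δ ≤ s - t) : s - t - 2 * δ ≤ ramp t s δ s := by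
  have hi : ∀ a b, IntervalIntegrable (trapezoid t s δ) volume a b := fun a b =>
    (continuous_trapezoid t s δ).intervalIntegrable a b
  have h1 : ∫ v in (t + δ)..(s - δ), trapezoid t s δ v = s - t - 2 * δ := by
    rw [intervalIntegral.integral_congr (g := fun _ => (1 : ℝ)) fun v hv => ?_]
    · simp
      ring
    · rw [Set.uIcc_of_le (by linarith)] at hv
      exact trapezoid_eq_one hδ hv.1 hv.2
  have h2 : 0 ≤ ∫ v in t..(t + δ), trapezoid t s δ v :=
    intervalIntegral.integral_nonneg (by linarith) fun v _ => trapezoid_nonneg t s δ v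
  have h3 : 0 ≤ ∫ v in (s - δ)..s, trapezoid t s δ v :=
    intervalIntegral.integral_nonneg (by linarith) fun v _ => trapezoid_nonneg t s δ v
  unfold ramp
  rw [← intervalIntegral.integral_add_adjacent_intervals (hi t (t + δ)) (hi (t + δ) s),
    ← intervalIntegral.integral_add_adjacent_intervals (hi (t + δ) (s - δ)) (hi (s - δ) s)]
  linarith

end Trapezoid

/-! ### Dirichlet energy between levels, bounded by positive curvature. -/

section Energy

variable {G : Set Plane} {g g₀ : TensorField} {u : Plane → ℝ} {t s δ : ℝ}

/-- `|∇u|²` times the area density of `g`. -/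
noncomputable def energyDensity (g : TensorField) (u : Plane → ℝ) (x : Plane) : ℝ :=
  partialD 0 u x * gradFlux g u 0 x + partialD 1 u x * gradFlux g u 1 x

theorem continuousOn_energyDensity (hG : IsOpen G) (hg : IsRiemannianMetricOn g G)
    (hu : ContDiffOn ℝ ∞ u G) : ContinuousOn (energyDensity g u) G :=
  ((contDiffOn_partialD hG hu).continuousOn.mul (contDiffOn_gradFlux hG hg hu 0).continuousOn).add
    ((contDiffOn_partialD hG hu).continuousOn.mul (contDiffOn_gradFlux hG hg hu 1).continuousOn)

theorem contDiffOn_ramp_comp (hu : ContDiffOn ℝ ∞ u G) :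
    ContDiffOn ℝ 1 (fun x => ramp t s δ (u x)) G :=
  (contDiff_ramp t s δ).comp_contDiffOn (hu.of_le (by simp))

/-- Integration by parts against a function of `u` supported in a superlevel set. -/
theorem integral_ramp_mul_div (hG : IsOpen G) (hu : ContDiffOn ℝ ∞ u G)
    (hlev : IsCompact {x | x ∈ G ∧ t ≤ u x}) (hδ : 0 < δ) {Z₀ Z₁ : Plane → ℝ}
    (hZ₀ : ContDiffOn ℝ ∞ Z₀ G) (hZ₁ : ContDiffOn ℝ ∞ Z₁ G) :
    ∫ x in G, trapezoid t s δ (u x) * (partialD 0 u x * Z₀ x + partialD 1 u x * Z₁ x)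
      = -∫ x in G, ramp t s δ (u x) * (partialD 0 Z₀ x + partialD 1 Z₁ x) := by
  have cψ := contDiffOn_ramp_comp (t := t) (s := s) (δ := δ) hu
  have cη : ContinuousOn (fun x => trapezoid t s δ (u x)) G :=
    (continuous_trapezoid t s δ).comp_continuousOn hu.continuousOn
  have cp := fun k => (contDiffOn_partialD (k := k) hG hu).continuousOn
  have hzero : ∀ x ∈ G, x ∉ {x | x ∈ G ∧ t ≤ u x} → u x ≤ t := fun x hx hn =>
    le_of_not_ge fun h => hn ⟨hx, h⟩
  have hsub : {x | x ∈ G ∧ t ≤ u x} ⊆ G := fun x hx => hx.1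
  have key : ∀ (k : Fin 2) (Z : Plane → ℝ), ContDiffOn ℝ ∞ Z G →
      IntegrableOn (fun x => trapezoid t s δ (u x) * (partialD k u x * Z x)) G ∧
      IntegrableOn (fun x => ramp t s δ (u x) * partialD k Z x) G ∧
      ∫ x in G, trapezoid t s δ (u x) * (partialD k u x * Z x)
        = -∫ x in G, ramp t s δ (u x) * partialD k Z x := by
    intro k Z hZ
    have i1 : IntegrableOn (fun x => trapezoid t s δ (u x) * (partialD k u x * Z x)) G :=
      integrableOn_of_eq_zero_off_compact hG hlev hsub
        (cη.mul ((cp k).mul hZ.continuousOn)) fun x hx hn => by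
          rw [trapezoid_eq_zero hδ (Or.inl (hzero x hx hn)), zero_mul]
    have i2 : IntegrableOn (fun x => ramp t s δ (u x) * partialD k Z x) G :=
      integrableOn_of_eq_zero_off_compact hG hlev hsub
        (cψ.continuousOn.mul (contDiffOn_partialD hG hZ).continuousOn) fun x hx hn => by
          rw [ramp_of_le hδ (hzero x hx hn), zero_mul]
    refine ⟨i1, i2, ?_⟩
    have h0 := integral_partialD_eq_zero hG hlev hsub
      (cψ.mul (hZ.of_le (by simp) : ContDiffOn ℝ 1 Z G)) (fun x hx hn => by
        rw [ramp_of_le hδ (hzero x hx hn), zero_mul]) k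
    have h1 : ∫ x in G, partialD k (fun x => ramp t s δ (u x) * Z x) x
        = ∫ x in G, (trapezoid t s δ (u x) * (partialD k u x * Z x)
          + ramp t s δ (u x) * partialD k Z x) := by
      refine setIntegral_congr_fun hG.measurableSet fun x hx => ?_
      have du := hu.differentiableAt_of_isOpen hG hx
      have dψ : DifferentiableAt ℝ (fun x => ramp t s δ (u x)) x :=
        (cψ.differentiableOn one_ne_zero).differentiableAt (hG.mem_nhds hx)
      show partialD k (fun x => ramp t s δ (u x) * Z x) x = _
      rw [partialD_mul dψ (hZ.differentiableAt_of_isOpen hG hx),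
        partialD_comp (hasDerivAt_ramp t s δ (u x)) du]
      ring
    rw [h1, integral_add i1 i2] at h0
    linarith
  obtain ⟨a1, a2, a3⟩ := key 0 Z₀ hZ₀
  obtain ⟨b1, b2, b3⟩ := key 1 Z₁ hZ₁
  simp only [mul_add]
  rw [integral_add a1 b1, integral_add a2 b2, a3, b3]
  ring

/-- The curvature equation tested with `ramp (u)`, whose gradient is `trapezoid (u) ∇u`. -/
theorem integral_trapezoid_mul_energyDensity (hG : IsOpen G) (hg : IsRiemannianMetricOn g G)
    (hg₀ : IsRiemannianMetricOn g₀ G) (hflat : IsFlatOn g₀ G)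
    (hconf : ∀ x ∈ G, g x = Real.exp (2 * u x) • g₀ x)
    (hlev : IsCompact {x | x ∈ G ∧ t ≤ u x}) (hδ : 0 < δ) :
    ∫ x in G, trapezoid t s δ (u x) * energyDensity g₀ u x
      = ∫ x in G, ramp t s δ (u x) * (gaussCurvature g x * Real.sqrt (g x).det) := by
  have hu := contDiffOn_of_conformal hg hg₀ hconf
  unfold energyDensity
  rw [integral_ramp_mul_div hG hu hlev hδ (contDiffOn_gradFlux hG hg₀ hu 0)
    (contDiffOn_gradFlux hG hg₀ hu 1), ← integral_neg]
  refine setIntegral_congr_fun hG.measurableSet fun x hx => ?_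
  simp only [gaussCurvature_conformal hG hg hg₀ hflat hconf hx]
  ring

/-- The total positive curvature of a superlevel set bounds the Dirichlet energy. -/
theorem integral_trapezoid_mul_energyDensity_le (hG : IsOpen G) (hg : IsRiemannianMetricOn g G)
    (hg₀ : IsRiemannianMetricOn g₀ G) (hflat : IsFlatOn g₀ G)
    (hconf : ∀ x ∈ G, g x = Real.exp (2 * u x) • g₀ x)
    (hlev : IsCompact {x | x ∈ G ∧ t ≤ u x}) (hδ : 0 < δ) :
    ∫ x in G, trapezoid t s δ (u x) * energyDensity g₀ u x
      ≤ ramp t s δ s * ∫ x in {x | x ∈ G ∧ t < u x},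
        max (gaussCurvature g x) 0 * Real.sqrt (g x).det := by
  have hu := contDiffOn_of_conformal hg hg₀ hconf
  have hsub : {x | x ∈ G ∧ t ≤ u x} ⊆ G := fun x hx => hx.1
  have cS : ContinuousOn (fun x => Real.sqrt (g x).det) G := hg.contDiffOn_sqrt_det.continuousOn
  have cK := continuousOn_gaussCurvature hG hg
  have hopen : IsOpen {x | x ∈ G ∧ t < u x} := hu.continuousOn.isOpen_inter_preimage hG isOpen_Ioi
  have hKp : ContinuousOn (fun x => max (gaussCurvature g x) 0 * Real.sqrt (g x).det) G :=
    (cK.sup continuousOn_const).mul cS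
  rw [integral_trapezoid_mul_energyDensity hG hg hg₀ hflat hconf hlev hδ, ← integral_const_mul]
  have hvan : ∀ x ∈ G \ {x | x ∈ G ∧ t < u x},
      ramp t s δ (u x) * (gaussCurvature g x * Real.sqrt (g x).det) = 0 := fun x hx => by
    rw [ramp_of_le hδ (le_of_not_gt fun h => hx.2 ⟨hx.1, h⟩), zero_mul]
  rw [setIntegral_eq_of_subset_of_forall_sdiff_eq_zero hG.measurableSet
    (fun x (hx : x ∈ {x | x ∈ G ∧ t < u x}) => hx.1) hvan]
  refine setIntegral_mono_on ?_ ?_ hopen.measurableSet fun x hx => ?_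
  · refine IntegrableOn.mono_set (t := {x | x ∈ G ∧ t ≤ u x}) ?_ fun x hx => ⟨hx.1, le_of_lt hx.2⟩
    exact ((((contDiff_ramp t s δ).continuous.comp_continuousOn hu.continuousOn).mul
      (cK.mul cS)).mono hsub).integrableOn_compact hlev
  · refine IntegrableOn.mono_set (t := {x | x ∈ G ∧ t ≤ u x}) ?_ fun x hx => ⟨hx.1, le_of_lt hx.2⟩
    exact ((continuousOn_const.mul hKp).mono hsub).integrableOn_compact hlev
  · calc ramp t s δ (u x) * (gaussCurvature g x * Real.sqrt (g x).det)
        ≤ ramp t s δ (u x) * (max (gaussCurvature g x) 0 * Real.sqrt (g x).det) :=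
          mul_le_mul_of_nonneg_left (mul_le_mul_of_nonneg_right (le_max_left _ _)
            (Real.sqrt_nonneg _)) (ramp_nonneg hδ _)
      _ ≤ _ := mul_le_mul_of_nonneg_right (ramp_le hδ _)
          (mul_nonneg (le_max_right _ _) (Real.sqrt_nonneg _))

end Energy

/-! ### Chain rule and Jacobian for maps of the plane given by components. -/

section DevelopingMap

variable {G : Set Plane} {F₁ F₂ : Plane → ℝ} {x : Plane}

theorem differentiableAt_planeMap (h₁ : DifferentiableAt ℝ F₁ x) (h₂ : DifferentiableAt ℝ F₂ x) :
    DifferentiableAt ℝ (fun y => (!₂[F₁ y, F₂ y] : Plane)) x := by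
  rw [differentiableAt_euclidean]
  intro i
  fin_cases i
  · exact h₁
  · exact h₂

theorem fderiv_planeMap (h₁ : DifferentiableAt ℝ F₁ x) (h₂ : DifferentiableAt ℝ F₂ x) (v : Plane) :
    fderiv ℝ (fun y => (!₂[F₁ y, F₂ y] : Plane)) x v 0 = fderiv ℝ F₁ x v ∧
      fderiv ℝ (fun y => (!₂[F₁ y, F₂ y] : Plane)) x v 1 = fderiv ℝ F₂ x v := by
  have h := fun i : Fin 2 => ((EuclideanSpace.proj (𝕜 := ℝ) i).hasFDerivAt.comp x
    (differentiableAt_planeMap h₁ h₂).hasFDerivAt).fderiv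
  have e0 : fderiv ℝ F₁ x = _ := h 0
  have e1 : fderiv ℝ F₂ x = _ := h 1
  constructor
  · exact (congrArg (fun L : Plane →L[ℝ] ℝ => L v) e0).symm
  · exact (congrArg (fun L : Plane →L[ℝ] ℝ => L v) e1).symm

theorem partialD_comp_planeMap {X : Plane → ℝ} (k : Fin 2)
    (hX : Differentiable ℝ X) (h₁ : DifferentiableAt ℝ F₁ x) (h₂ : DifferentiableAt ℝ F₂ x) :
    partialD k (fun y => X !₂[F₁ y, F₂ y]) x
      = partialD k F₁ x * partialD 0 X !₂[F₁ x, F₂ x]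
        + partialD k F₂ x * partialD 1 X !₂[F₁ x, F₂ x] := by
  have h := ((hX !₂[F₁ x, F₂ x]).hasFDerivAt.comp x
    (differentiableAt_planeMap h₁ h₂).hasFDerivAt).partialD (k := k)
  refine h.trans ?_
  have hv := fderiv_planeMap h₁ h₂ (EuclideanSpace.single k (1 : ℝ))
  rw [ContinuousLinearMap.comp_apply, apply_eq_sum_single, hv.1, hv.2]
  rfl

theorem det_fderiv_planeMap (h₁ : DifferentiableAt ℝ F₁ x) (h₂ : DifferentiableAt ℝ F₂ x) :
    (fderiv ℝ (fun y => (!₂[F₁ y, F₂ y] : Plane)) x).det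
      = partialD 0 F₁ x * partialD 1 F₂ x - partialD 1 F₁ x * partialD 0 F₂ x := by
  have hv := fun k : Fin 2 => fderiv_planeMap h₁ h₂ (EuclideanSpace.single k (1 : ℝ))
  rw [ContinuousLinearMap.det, ← LinearMap.det_toMatrix (EuclideanSpace.basisFun (Fin 2) ℝ).toBasis,
    Matrix.det_fin_two]
  simp [LinearMap.toMatrix_apply, (hv 0).1, (hv 0).2, (hv 1).1, (hv 1).2, partialD]

end DevelopingMap

/-! ### Isoperimetric inequality by pulling back the Newtonian field. -/

section Isoperimetric

variable {G : Set Plane} {g : TensorField} {u F₁ F₂ : Plane → ℝ} {t s δ : ℝ}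

/-- Only an inequality, because the developing map may overlap itself; its Jacobian is the area
density of `g`. -/
theorem IsDevelopingMap.volume_image_le (hF : IsDevelopingMap G g F₁ F₂) (hG : IsOpen G)
    (hg : IsRiemannianMetricOn g G) {E : Set Plane} (hE : IsCompact E) (hEG : E ⊆ G) :
    volume.real ((fun y => (!₂[F₁ y, F₂ y] : Plane)) '' E) ≤ ∫ x in E, Real.sqrt (g x).det := by
  have d₁ := fun x (hx : x ∈ G) => hF.1.differentiableAt_of_isOpen hG hx
  have d₂ := fun x (hx : x ∈ G) => hF.2.1.differentiableAt_of_isOpen hG hx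
  have h := addHaar_image_le_lintegral_abs_det_fderiv (volume : Measure Plane) hE.measurableSet
    fun x hx => (differentiableAt_planeMap (d₁ x (hEG hx)) (d₂ x (hEG hx))).hasFDerivAt
      |>.hasFDerivWithinAt (s := E)
  rw [setLIntegral_congr_fun (g := fun x => ENNReal.ofReal (Real.sqrt (g x).det)) hE.measurableSet
    fun x hx => by
      simp only [det_fderiv_planeMap (d₁ x (hEG hx)) (d₂ x (hEG hx)), (hF.2.2 x (hEG hx)).2,
        abs_of_nonneg (Real.sqrt_nonneg _)]] at h
  have hint : IntegrableOn (fun x => Real.sqrt (g x).det) E :=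
    (hg.contDiffOn_sqrt_det.continuousOn.mono hEG).integrableOn_compact hE
  rw [← ofReal_integral_eq_lintegral_ofReal hint
    (Eventually.of_forall fun x => Real.sqrt_nonneg _)] at h
  exact ENNReal.toReal_le_of_le_ofReal (integral_nonneg fun x => Real.sqrt_nonneg _) h

/-- The Piola identity: the pull-back of a vector field by a local isometry. -/
theorem IsDevelopingMap.div_pullback (hF : IsDevelopingMap G g F₁ F₂) (hG : IsOpen G)
    {X₀ X₁ : Plane → ℝ} (hX₀ : ContDiff ℝ ∞ X₀) (hX₁ : ContDiff ℝ ∞ X₁) {x : Plane} (hx : x ∈ G) :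
    partialD 0 (fun y => partialD 1 F₂ y * X₀ !₂[F₁ y, F₂ y]
        - partialD 1 F₁ y * X₁ !₂[F₁ y, F₂ y]) x
      + partialD 1 (fun y => partialD 0 F₁ y * X₁ !₂[F₁ y, F₂ y]
        - partialD 0 F₂ y * X₀ !₂[F₁ y, F₂ y]) x
      = Real.sqrt (g x).det
        * (partialD 0 X₀ !₂[F₁ x, F₂ x] + partialD 1 X₁ !₂[F₁ x, F₂ x]) := by
  have d₁ := hF.1.differentiableAt_of_isOpen hG hx
  have d₂ := hF.2.1.differentiableAt_of_isOpen hG hx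
  have e₁ := fun k => (contDiffOn_partialD (k := k) hG hF.1).differentiableAt_of_isOpen hG hx
  have e₂ := fun k => (contDiffOn_partialD (k := k) hG hF.2.1).differentiableAt_of_isOpen hG hx
  have dX₀ : Differentiable ℝ X₀ := hX₀.differentiable (by simp)
  have dX₁ : Differentiable ℝ X₁ := hX₁.differentiable (by simp)
  have c₀ : DifferentiableAt ℝ (fun y => X₀ !₂[F₁ y, F₂ y]) x :=
    (dX₀ _).comp x (differentiableAt_planeMap d₁ d₂)
  have c₁ : DifferentiableAt ℝ (fun y => X₁ !₂[F₁ y, F₂ y]) x :=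
    (dX₁ _).comp x (differentiableAt_planeMap d₁ d₂)
  rw [partialD_sub (f := fun y => partialD 1 F₂ y * X₀ !₂[F₁ y, F₂ y])
      (h := fun y => partialD 1 F₁ y * X₁ !₂[F₁ y, F₂ y]) ((e₂ 1).mul c₀) ((e₁ 1).mul c₁),
    partialD_sub (f := fun y => partialD 0 F₁ y * X₁ !₂[F₁ y, F₂ y])
      (h := fun y => partialD 0 F₂ y * X₀ !₂[F₁ y, F₂ y]) ((e₁ 0).mul c₁) ((e₂ 0).mul c₀),
    partialD_mul (e₂ 1) c₀, partialD_mul (e₁ 1) c₁, partialD_mul (e₁ 0) c₁, partialD_mul (e₂ 0) c₀,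
    partialD_comp_planeMap 0 dX₀ d₁ d₂, partialD_comp_planeMap 1 dX₀ d₁ d₂,
    partialD_comp_planeMap 0 dX₁ d₁ d₂, partialD_comp_planeMap 1 dX₁ d₁ d₂,
    partialD_comm hG hF.1 hx 1 0, partialD_comm hG hF.2.1 hx 1 0, ← (hF.2.2 x hx).2]
  ring

/-- Since `F₁, F₂` are locally Euclidean coordinates, the Jacobian brackets of `u` with them are, up
to a quarter turn, the area density times the components of the gradient. -/
theorem IsDevelopingMap.energyDensity_mul (hF : IsDevelopingMap G g F₁ F₂)
    (hg : IsRiemannianMetricOn g G) {x : Plane} (hx : x ∈ G) :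
    energyDensity g u x * Real.sqrt (g x).det
      = (partialD 1 F₁ x * partialD 0 u x - partialD 0 F₁ x * partialD 1 u x) ^ 2
        + (partialD 1 F₂ x * partialD 0 u x - partialD 0 F₂ x * partialD 1 u x) ^ 2 := by
  have hS := (Real.sqrt_pos.2 (hg.det_pos hx)).ne'
  have h := (hF.2.2 x hx).1
  simp only [energyDensity, gradFlux, Matrix.cons_val_zero, Matrix.cons_val_one]
  field_simp
  rw [h 0 0, h 0 1, h 1 1]
  ring

theorem IsDevelopingMap.energyDensity_nonneg (hF : IsDevelopingMap G g F₁ F₂)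
    (hg : IsRiemannianMetricOn g G) {x : Plane} (hx : x ∈ G) : 0 ≤ energyDensity g u x := by
  have h := hF.energyDensity_mul (u := u) hg hx
  have hS := Real.sqrt_pos.2 (hg.det_pos hx)
  by_contra hn
  have := mul_neg_of_neg_of_pos (not_le.1 hn) hS
  rw [h] at this
  exact absurd this (not_lt.2 (by positivity))

/-- The isoperimetric inequality for superlevel sets of `u` on a surface with a developing map,
combined with the Cauchy–Schwarz inequality. -/
theorem IsDevelopingMap.isoperimetric (hF : IsDevelopingMap G g F₁ F₂) (hG : IsOpen G)
    (hg : IsRiemannianMetricOn g G) (hu : ContDiffOn ℝ ∞ u G)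
    (hlev : IsCompact {x | x ∈ G ∧ t ≤ u x}) (hlev' : IsCompact {x | x ∈ G ∧ s ≤ u x})
    (hδ : 0 < δ) :
    4 * Real.pi * ramp t s δ s ^ 2 * ∫ x in {x | x ∈ G ∧ s ≤ u x}, Real.sqrt (g x).det
      ≤ (∫ x in G, trapezoid t s δ (u x) * energyDensity g u x)
        * ∫ x in G, trapezoid t s δ (u x) * Real.sqrt (g x).det := by
  set E := {x | x ∈ G ∧ s ≤ u x} with hE
  set I := ramp t s δ s with hI
  set F : Plane → Plane := fun y => !₂[F₁ y, F₂ y] with hFdef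
  have hI0 : 0 ≤ I := ramp_nonneg hδ s
  have hEG : E ⊆ G := fun x hx => hx.1
  have hKG : {x | x ∈ G ∧ t ≤ u x} ⊆ G := fun x hx => hx.1
  have hzero : ∀ x ∈ G, x ∉ {x | x ∈ G ∧ t ≤ u x} → u x ≤ t := fun x hx hn =>
    le_of_not_ge fun h => hn ⟨hx, h⟩
  have cS : ContinuousOn (fun x => Real.sqrt (g x).det) G := hg.contDiffOn_sqrt_det.continuousOn
  have ce := continuousOn_energyDensity hG hg hu
  have cη : ContinuousOn (fun x => trapezoid t s δ (u x)) G :=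
    (continuous_trapezoid t s δ).comp_continuousOn hu.continuousOn
  have cψ : ContinuousOn (fun x => ramp t s δ (u x)) G := (contDiffOn_ramp_comp hu).continuousOn
  have cF : ContinuousOn F G := fun x hx => (differentiableAt_planeMap
    (hF.1.differentiableAt_of_isOpen hG hx)
    (hF.2.1.differentiableAt_of_isOpen hG hx)).continuousAt.continuousWithinAt
  have intη : ∀ f : Plane → ℝ, ContinuousOn f G →
      IntegrableOn (fun x => trapezoid t s δ (u x) * f x) G := fun f hf =>
    integrableOn_of_eq_zero_off_compact hG hlev hKG (cη.mul hf) fun x hx hn => by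
      rw [trapezoid_eq_zero hδ (Or.inl (hzero x hx hn)), zero_mul]
  have intψ : ∀ f : Plane → ℝ, ContinuousOn f G →
      IntegrableOn (fun x => ramp t s δ (u x) * f x) G := fun f hf =>
    integrableOn_of_eq_zero_off_compact hG hlev hKG (cψ.mul hf) fun x hx hn => by
      rw [ramp_of_le hδ (hzero x hx hn), zero_mul]
  set A := ∫ x in E, Real.sqrt (g x).det with hA
  set P := ∫ x in G, trapezoid t s δ (u x) * energyDensity g u x with hP
  set R := ∫ x in G, trapezoid t s δ (u x) * Real.sqrt (g x).det with hR
  have hA0 : 0 ≤ A := integral_nonneg fun x => Real.sqrt_nonneg _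
  have hP0 : 0 ≤ P := setIntegral_nonneg hG.measurableSet fun x hx =>
    mul_nonneg (trapezoid_nonneg _ _ _ _) (hF.energyDensity_nonneg hg hx)
  have hR0 : 0 ≤ R := setIntegral_nonneg hG.measurableSet fun x _ =>
    mul_nonneg (trapezoid_nonneg _ _ _ _) (Real.sqrt_nonneg _)
  -- The integrand is `|∇u|` times the area density; `T` plays the part of `∫ L(r) dr`, the lengths
  -- of the level curves integrated over the levels between `t` and `s`.
  set T := ∫ x in G, trapezoid t s δ (u x) * Real.sqrt (energyDensity g u x * Real.sqrt (g x).det)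
    with hT
  have hT0 : 0 ≤ T := setIntegral_nonneg hG.measurableSet fun x _ =>
    mul_nonneg (trapezoid_nonneg _ _ _ _) (Real.sqrt_nonneg _)
  have hCS : T ^ 2 ≤ P * R := by
    have e : ∀ x, Real.sqrt ((trapezoid t s δ (u x) * energyDensity g u x)
        * (trapezoid t s δ (u x) * Real.sqrt (g x).det))
        = trapezoid t s δ (u x) * Real.sqrt (energyDensity g u x * Real.sqrt (g x).det) := by
      intro x
      rw [show (trapezoid t s δ (u x) * energyDensity g u x)
        * (trapezoid t s δ (u x) * Real.sqrt (g x).det)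
        = trapezoid t s δ (u x) ^ 2 * (energyDensity g u x * Real.sqrt (g x).det) by ring,
        Real.sqrt_mul (sq_nonneg _), Real.sqrt_sq (trapezoid_nonneg _ _ _ _)]
    have h := sq_integral_sqrt_mul_le (intη _ ce) (intη _ cS) (by
        simp only [e]
        exact intη _ (ce.mul cS).sqrt)
      ((ae_restrict_iff' hG.measurableSet).2 (Eventually.of_forall fun x hx =>
        mul_nonneg (trapezoid_nonneg _ _ _ _) (hF.energyDensity_nonneg hg hx)))
      (Eventually.of_forall fun x => mul_nonneg (trapezoid_nonneg _ _ _ _) (Real.sqrt_nonneg _))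
    simp only [e] at h
    exact h
  -- Here `ε` is the excess of `∫ h` over the area of the image `F(E)`.
  have main : ∀ ε : ℝ, 0 < ε → 4 * Real.pi * (I * A) ^ 2 ≤ (A + ε) * (P * R) := by
    intro ε hε
    obtain ⟨h, hsm, hcs, h0, h1, hone, hint⟩ :=
      exists_smooth_cutoff (hlev'.image_of_continuousOn (cF.mono hEG)) hε
    have hH : ∫ y, h y ≤ A + ε := hint.trans (by
      have := hF.volume_image_le hG hg hlev' hEG
      linarith)
    set X₀ := newtonField h 0
    set X₁ := newtonField h 1
    have sX₀ : ContDiff ℝ ∞ X₀ := contDiff_newtonField hsm hcs 0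
    have sX₁ : ContDiff ℝ ∞ X₁ := contDiff_newtonField hsm hcs 1
    have sF : ContDiffOn ℝ ∞ F G := by
      rw [contDiffOn_euclidean]
      intro i
      fin_cases i
      · exact hF.1
      · exact hF.2.1
    have p₁ := fun k => contDiffOn_partialD (k := k) hG hF.1
    have p₂ := fun k => contDiffOn_partialD (k := k) hG hF.2.1
    have q₀ : ContDiffOn ℝ ∞ (fun y => X₀ (F y)) G := sX₀.comp_contDiffOn sF
    have q₁ : ContDiffOn ℝ ∞ (fun y => X₁ (F y)) G := sX₁.comp_contDiffOn sF
    -- The pull-back of `X`, multiplied by the area density; by the Piola identity its divergence is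
    -- `√det g · h ∘ F`.
    set Z₀ : Plane → ℝ := fun y => partialD 1 F₂ y * X₀ (F y) - partialD 1 F₁ y * X₁ (F y)
    set Z₁ : Plane → ℝ := fun y => partialD 0 F₁ y * X₁ (F y) - partialD 0 F₂ y * X₀ (F y)
    have sZ₀ : ContDiffOn ℝ ∞ Z₀ G := ((p₂ 1).mul q₀).sub ((p₁ 1).mul q₁)
    have sZ₁ : ContDiffOn ℝ ∞ Z₁ G := ((p₁ 0).mul q₁).sub ((p₂ 0).mul q₀)
    have hdiv : ∀ x ∈ G, partialD 0 Z₀ x + partialD 1 Z₁ x = Real.sqrt (g x).det * h (F x) :=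
      fun x hx => (hF.div_pullback hG sX₀ sX₁ hx).trans (by
        rw [newtonField_div hsm hcs])
    have hibp := integral_ramp_mul_div (s := s) hG hu hlev hδ sZ₀ sZ₁
    -- On `E` the truncation has reached its full height `I` and `h ∘ F = 1`; elsewhere the
    -- integrand is nonnegative.
    have hlow : I * A ≤ ∫ x in G, ramp t s δ (u x) * (partialD 0 Z₀ x + partialD 1 Z₁ x) := by
      have e1 : ∫ x in G, ramp t s δ (u x) * (partialD 0 Z₀ x + partialD 1 Z₁ x)
          = ∫ x in G, ramp t s δ (u x) * (Real.sqrt (g x).det * h (F x)) :=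
        setIntegral_congr_fun hG.measurableSet fun x hx => by simp only [hdiv x hx]
      have i1 := intψ (fun x => Real.sqrt (g x).det * h (F x))
        (cS.mul (hsm.continuous.comp_continuousOn cF))
      rw [e1, hA, ← integral_const_mul]
      calc ∫ x in E, I * Real.sqrt (g x).det
          ≤ ∫ x in E, ramp t s δ (u x) * (Real.sqrt (g x).det * h (F x)) := by
            refine setIntegral_mono_on ?_ (i1.mono_set hEG) hlev'.measurableSet fun x hx => ?_
            · exact (continuousOn_const.mul (cS.mono hEG)).integrableOn_compact hlev'
            · rw [hone (F x) (Set.mem_image_of_mem F hx), mul_one]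
              exact mul_le_mul_of_nonneg_right (monotone_ramp t s δ hx.2) (Real.sqrt_nonneg _)
        _ ≤ _ := setIntegral_mono_set i1 (Eventually.of_forall fun x =>
            mul_nonneg (ramp_nonneg hδ _) (mul_nonneg (Real.sqrt_nonneg _) (h0 _)))
            (Eventually.of_forall hEG)
    have hH0 : 0 ≤ ∫ y, h y := integral_nonneg h0
    -- The supremum bound for `|X|` given by `newtonField_bound`.
    set c := Real.sqrt ((∫ y, h y) / (4 * Real.pi)) with hc
    have hc2 : 4 * Real.pi * c ^ 2 = ∫ y, h y := by
      rw [hc, Real.sq_sqrt (by positivity)]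
      field_simp
    have hup : ∫ x in G, ramp t s δ (u x) * (partialD 0 Z₀ x + partialD 1 Z₁ x) ≤ c * T := by
      have e1 : ∫ x in G, ramp t s δ (u x) * (partialD 0 Z₀ x + partialD 1 Z₁ x)
          = ∫ x in G, trapezoid t s δ (u x) * -(partialD 0 u x * Z₀ x + partialD 1 u x * Z₁ x) := by
        simp only [mul_neg]
        rw [integral_neg, hibp, neg_neg]
      have cu := fun k => (contDiffOn_partialD (k := k) hG hu).continuousOn
      rw [e1, hT, ← integral_const_mul]
      refine setIntegral_mono_on (intη _ (((cu 0).mul sZ₀.continuousOn).add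
        ((cu 1).mul sZ₁.continuousOn)).neg) ((intη _ (ce.mul cS).sqrt).const_mul c)
        hG.measurableSet fun x hx => ?_
      rw [mul_left_comm]
      refine mul_le_mul_of_nonneg_left ?_ (trapezoid_nonneg _ _ _ _)
      refine (neg_le_abs _).trans (abs_le_of_sq_le_sq ?_ (by positivity))
      have hb := newtonField_bound hsm hcs h0 h1 (F x)
      have hb' : X₀ (F x) ^ 2 + X₁ (F x) ^ 2 ≤ c ^ 2 := by
        have : 4 * Real.pi * (X₀ (F x) ^ 2 + X₁ (F x) ^ 2) ≤ 4 * Real.pi * c ^ 2 := by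
          rw [hc2]; exact hb
        exact le_of_mul_le_mul_left this (by positivity)
      have hen := hF.energyDensity_mul (u := u) hg hx
      have hnn : 0 ≤ energyDensity g u x * Real.sqrt (g x).det :=
        mul_nonneg (hF.energyDensity_nonneg hg hx) (Real.sqrt_nonneg _)
      rw [mul_pow, Real.sq_sqrt hnn]
      refine le_trans ?_ (mul_le_mul_of_nonneg_right hb' hnn)
      rw [hen]
      simp only [Z₀, Z₁]
      set a := partialD 1 F₁ x * partialD 0 u x - partialD 0 F₁ x * partialD 1 u x
      set b := partialD 1 F₂ x * partialD 0 u x - partialD 0 F₂ x * partialD 1 u x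
      have e2 : partialD 0 u x * (partialD 1 F₂ x * X₀ (F x) - partialD 1 F₁ x * X₁ (F x))
          + partialD 1 u x * (partialD 0 F₁ x * X₁ (F x) - partialD 0 F₂ x * X₀ (F x))
          = X₀ (F x) * b - X₁ (F x) * a := by
        simp only [a, b]; ring
      rw [e2]
      -- Lagrange's identity `(X₀ b - X₁ a)² + (X₀ a + X₁ b)² = (X₀² + X₁²) (a² + b²)`.
      nlinarith [sq_nonneg (X₀ (F x) * a + X₁ (F x) * b)]
    have hIA : 0 ≤ I * A := mul_nonneg hI0 hA0
    have h2 : (I * A) ^ 2 ≤ (c * T) ^ 2 := pow_le_pow_left₀ hIA (hlow.trans hup) 2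
    calc 4 * Real.pi * (I * A) ^ 2 ≤ 4 * Real.pi * (c * T) ^ 2 :=
          mul_le_mul_of_nonneg_left h2 (by positivity)
      _ = (∫ y, h y) * T ^ 2 := by rw [← hc2]; ring
      _ ≤ (A + ε) * (P * R) := mul_le_mul hH hCS (sq_nonneg _) (by linarith)
  have hlim : 4 * Real.pi * (I * A) ^ 2 ≤ A * (P * R) := by
    have ht : Tendsto (fun ε : ℝ => (A + ε) * (P * R)) (𝓝[>] 0) (𝓝 ((A + 0) * (P * R))) :=
      (Continuous.tendsto (by fun_prop) 0).mono_left nhdsWithin_le_nhds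
    rw [add_zero] at ht
    exact ge_of_tendsto ht (by filter_upwards [self_mem_nhdsWithin] with ε hε using main ε hε)
  rcases hA0.eq_or_lt with hz | hpos
  · rw [← hz, mul_zero]
    exact mul_nonneg hP0 hR0
  · refine le_of_mul_le_mul_left ?_ hpos
    calc A * (4 * Real.pi * I ^ 2 * A) = 4 * Real.pi * (I * A) ^ 2 := by ring
      _ ≤ _ := hlim

end Isoperimetric

/-! ### Differential inequalities for the level functions and the height bound. -/

section Comparison

theorem exp_sub_exp_le {r s : ℝ} : Real.exp (2 * s) - Real.exp (2 * r)
    ≤ 2 * (s - r) * Real.exp (2 * s) := by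
  have h := Real.add_one_le_exp (2 * r - 2 * s)
  have h2 : Real.exp (2 * r) = Real.exp (2 * s) * Real.exp (2 * r - 2 * s) := by
    rw [← Real.exp_add]; congr 1; ring
  have h3 := Real.exp_pos (2 * s)
  rw [h2]
  nlinarith

/-- A function which on small intervals decreases up to an error of higher order, measured by the
oscillation of `A`, decreases. -/
theorem le_of_forall_sub_le_mul {φ A : ℝ → ℝ} {t s C : ℝ} (hts : t ≤ s)
    (h : ∀ r r', t ≤ r → r ≤ r' → r' ≤ s → φ r' - φ r ≤ C * (r' - r) * (A r - A r')) :
    φ s ≤ φ t := by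
  -- On `n + 1` equal pieces the errors telescope to `C w (A t - A s)` with `w` the length of a
  -- piece, and this tends to `0`. No continuity of `φ` or `A` is needed.
  have step : ∀ n : ℕ, φ s - φ t ≤ C * ((s - t) / (n + 1)) * (A t - A s) := by
    intro n
    have hn : (0:ℝ) < n + 1 := by positivity
    set w := (s - t) / (n + 1) with hw
    have hw0 : 0 ≤ w := div_nonneg (by linarith) hn.le
    have hws : (n + 1) * w = s - t := by rw [hw]; field_simp
    have key : ∀ k : ℕ, k ≤ n + 1 → φ (t + k * w) - φ t ≤ C * w * (A t - A (t + k * w)) := by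
      intro k
      induction k with
      | zero => intro _; simp
      | succ k ih =>
        intro hk
        have hk1 : (k : ℝ) + 1 ≤ n + 1 := by exact_mod_cast hk
        have h1 := ih (by omega)
        have h2 := h (t + k * w) (t + (k + 1) * w) (by nlinarith [k.cast_nonneg (α := ℝ)])
          (by nlinarith) (by nlinarith)
        rw [show t + (k + 1) * w - (t + k * w) = w by ring] at h2
        push_cast
        linarith
    have hfin := key (n + 1) le_rfl
    push_cast at hfin
    rwa [hws, add_sub_cancel] at hfin
  have hlim : Tendsto (fun n : ℕ => C * ((s - t) / ((n:ℝ) + 1)) * (A t - A s)) atTop (𝓝 0) := by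
    have h1 : Tendsto (fun n : ℕ => (s - t) * (1 / ((n:ℝ) + 1))) atTop (𝓝 0) := by
      simpa using tendsto_one_div_add_atTop_nhds_zero_nat.const_mul (s - t)
    have h2 := (h1.const_mul C).mul_const (A t - A s)
    simp only [mul_zero, zero_mul] at h2
    refine h2.congr fun n => ?_
    ring
  linarith [ge_of_tendsto' hlim step]

/-- The data of the superlevel sets of `u`: `A t` is the area of `{u > t}` in the flat metric,
`V t` its area in the conformal metric, and `Φ t` its positive curvature. -/
structure LevelData (M : ℝ) (A V Φ : ℝ → ℝ) : Prop where
  isoperimetric : ∀ t s, 0 < t → t < s → s < M → 4 * Real.pi * (s - t) * A s ≤ Φ t * (A t - A s)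
  le_vol : ∀ t s, 0 < t → t ≤ s → Real.exp (2 * t) * (A t - A s) ≤ V t - V s
  vol_le : ∀ t s, 0 < t → t ≤ s → V t - V s ≤ Real.exp (2 * s) * (A t - A s)
  vol_le_exp : ∀ t, 0 < t → V t ≤ Real.exp (2 * M) * A t
  area_pos : ∀ t, 0 < t → t < M → 0 < A t
  antitone_area : ∀ t s, 0 < t → t ≤ s → A s ≤ A t
  antitone_curv : ∀ t s, 0 < t → t ≤ s → Φ s ≤ Φ t

variable {M : ℝ} {A V Φ : ℝ → ℝ}

/-- The isoperimetric inequality forces `A`, and with it `V`, to drop strictly below the maximal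
height. -/
theorem LevelData.vol_pos (h : LevelData M A V Φ) {t : ℝ} (ht : 0 < t) (htM : t < M)
    (hV : ∀ t, 0 < t → 0 ≤ V t) : 0 < V t := by
  obtain ⟨s, hts, hsM⟩ := exists_between htM
  have hs := ht.trans hts
  have h1 := h.isoperimetric t s ht hts hsM
  have h2 : 0 < 4 * Real.pi * (s - t) * A s :=
    mul_pos (mul_pos (by positivity) (by linarith)) (h.area_pos s hs hsM)
  have h3 : 0 < A t - A s := by
    refine (sub_nonneg.2 (h.antitone_area t s ht hts.le)).lt_of_ne fun h0 => ?_
    rw [← h0, mul_zero] at h1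
    linarith
  have h4 := h.le_vol t s ht hts.le
  have h5 : 0 < Real.exp (2 * t) * (A t - A s) := mul_pos (Real.exp_pos _) h3
  linarith [hV s hs]

/-- With `x = Φ t / 2π` fixed, `e^{2s} A - (1 - x) V` decreases for `s ≥ t`: formally its derivative
is `e^{2s} (2A + x A')`, which is not positive by the isoperimetric inequality and the monotonicity
of `Φ`. Near `M` the function is positive, because there `V ≤ e^{2M} A` and `e^{2s}` is close to
`e^{2M}`. -/
theorem LevelData.vol_mul_le (h : LevelData M A V Φ) {t : ℝ} (ht : 0 < t) (htM : t < M)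
    (hΦ0 : 0 ≤ Φ t) (hΦ : Φ t < 2 * Real.pi) :
    (1 - Φ t / (2 * Real.pi)) * V t ≤ Real.exp (2 * t) * A t := by
  have hpi := Real.pi_pos
  set x := Φ t / (2 * Real.pi) with hx
  have hx0 : 0 ≤ x := div_nonneg hΦ0 (by positivity)
  have hx1 : x < 1 := (div_lt_one (by positivity)).2 hΦ
  have hΦx : Φ t = 2 * Real.pi * x := by rw [hx]; field_simp
  -- Vanishing curvature above `t` would contradict the isoperimetric inequality; strict positivity
  -- gives the room needed near `M`.
  have hxpos : 0 < x := by
    refine hx0.lt_of_ne fun h0 => ?_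
    obtain ⟨s, hts, hsM⟩ := exists_between htM
    have h1 := h.isoperimetric t s ht hts hsM
    rw [hΦx, ← h0, mul_zero, zero_mul] at h1
    have h2 : 0 < 4 * Real.pi * (s - t) * A s :=
      mul_pos (mul_pos (by positivity) (by linarith)) (h.area_pos s (ht.trans hts) hsM)
    linarith
  have hmono : ∀ s, t ≤ s → s < M →
      Real.exp (2 * s) * A s - (1 - x) * V s ≤ Real.exp (2 * t) * A t - (1 - x) * V t := by
    intro s hts hsM
    refine le_of_forall_sub_le_mul (φ := fun s => Real.exp (2 * s) * A s - (1 - x) * V s)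
      (A := A) (C := 2 * Real.exp (2 * M)) hts fun r r' htr hrr' hr's => ?_
    have hr := ht.trans_le htr
    have hr'M := hr's.trans_lt hsM
    have hAd : 0 ≤ A r - A r' := sub_nonneg.2 (h.antitone_area r r' hr hrr')
    have h1 : 2 * (r' - r) * A r' ≤ x * (A r - A r') := by
      rcases hrr'.eq_or_lt with heq | hlt
      · subst heq; simp
      · have h2 := h.isoperimetric r r' hr hlt hr'M
        have h3 : Φ r * (A r - A r') ≤ 2 * Real.pi * x * (A r - A r') :=
          mul_le_mul_of_nonneg_right (hΦx ▸ h.antitone_curv t r ht htr) hAd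
        have h4 : 2 * Real.pi * (2 * (r' - r) * A r') ≤ 2 * Real.pi * (x * (A r - A r')) := by
          linarith
        exact le_of_mul_le_mul_left h4 (by positivity)
    have h2 := mul_le_mul_of_nonneg_left (h.vol_le r r' hr hrr') (sub_nonneg.2 hx1.le)
    have h3 := Real.exp_pos (2 * r')
    have h4 : (Real.exp (2 * r') - Real.exp (2 * r)) * A r
        ≤ 2 * (r' - r) * Real.exp (2 * r') * A r :=
      mul_le_mul_of_nonneg_right exp_sub_exp_le (h.area_pos r hr (hrr'.trans_lt hr'M)).le
    have h5 := mul_le_mul_of_nonneg_left h1 h3.le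
    have h6 : Real.exp (2 * r') ≤ Real.exp (2 * M) := Real.exp_le_exp.2 (by linarith)
    have h7 : Real.exp (2 * r') * ((r' - r) * (A r - A r'))
        ≤ Real.exp (2 * M) * ((r' - r) * (A r - A r')) :=
      mul_le_mul_of_nonneg_right h6 (mul_nonneg (by linarith) hAd)
    show (Real.exp (2 * r') * A r' - (1 - x) * V r') - (Real.exp (2 * r) * A r - (1 - x) * V r) ≤ _
    nlinarith
  have hlim : Tendsto (fun s => Real.exp (2 * s) - (1 - x) * Real.exp (2 * M)) (𝓝[<] M)
      (𝓝 (Real.exp (2 * M) - (1 - x) * Real.exp (2 * M))) :=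
    (Continuous.tendsto (by fun_prop) M).mono_left nhdsWithin_le_nhds
  have hposlim : 0 < Real.exp (2 * M) - (1 - x) * Real.exp (2 * M) := by
    have := mul_pos hxpos (Real.exp_pos (2 * M))
    linarith
  obtain ⟨s, hs1, hs2⟩ := ((hlim.eventually (lt_mem_nhds hposlim)).and
    (eventually_mem_set.2 (Ioo_mem_nhdsLT htM))).exists
  have h1 := hmono s hs2.1.le hs2.2
  have h2 := h.vol_le_exp s (ht.trans hs2.1)
  have h3 := mul_le_mul_of_nonneg_left h2 (sub_nonneg.2 hx1.le)
  have h4 := mul_pos hs1 (h.area_pos s (ht.trans hs2.1) hs2.2)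
  nlinarith

/-- The isoperimetric inequality between `r` and `s`, with `A s` bounded below by `vol_mul_le` and
`A r - A s` bounded above through `V r - V s`. The mismatch factor `e^{2r - 2s}` between the two
estimates tends to `1` as `s` decreases to `r`. -/
theorem LevelData.slope_bound (h : LevelData M A V Φ) (hΦ0 : ∀ t, 0 < t → 0 ≤ Φ t)
    (hΦ : ∀ t, 0 < t → Φ t < 2 * Real.pi) (hV : ∀ t, 0 < t → 0 ≤ V t) {r v' : ℝ} (hr : 0 < r)
    (hrM : r < M) (hd : HasDerivAt V v' r) :
    2 * (2 * Real.pi - Φ r) * V r ≤ Φ r * (-v') := by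
  have hpi := Real.pi_pos
  have hs : Tendsto (slope V r) (𝓝[>] r) (𝓝 v') :=
    hd.tendsto_slope.mono_left (nhdsWithin_mono r fun y (hy : r < y) => hy.ne')
  have hVc : Tendsto (fun s => 2 * (2 * Real.pi - Φ r) * V s * Real.exp (2 * r - 2 * s)) (𝓝[>] r)
      (𝓝 (2 * (2 * Real.pi - Φ r) * V r * Real.exp (2 * r - 2 * r))) := by
    have h1 : Tendsto V (𝓝[>] r) (𝓝 (V r)) := hd.continuousAt.tendsto.mono_left nhdsWithin_le_nhds
    have h2 : Tendsto (fun s => Real.exp (2 * r - 2 * s)) (𝓝[>] r) (𝓝 (Real.exp (2 * r - 2 * r))) :=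
      (Continuous.tendsto (by fun_prop) r).mono_left nhdsWithin_le_nhds
    exact (h1.const_mul _).mul h2
  rw [sub_self, Real.exp_zero, mul_one] at hVc
  refine le_of_tendsto_of_tendsto hVc (hs.neg.const_mul (Φ r)) ?_
  filter_upwards [Ioo_mem_nhdsGT hrM] with s hs
  have hs0 := hr.trans hs.1
  have hsr : 0 < s - r := sub_pos.2 hs.1
  have h1 := h.isoperimetric r s hr hs.1 hs.2
  have h2 := h.vol_mul_le hs0 hs.2 (hΦ0 s hs0) (hΦ s hs0)
  have h3 := h.antitone_curv r s hr hs.1.le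
  have h4 := h.le_vol r s hr hs.1.le
  have h5 : (1 - Φ r / (2 * Real.pi)) * V s ≤ Real.exp (2 * s) * A s := by
    refine le_trans (mul_le_mul_of_nonneg_right ?_ (hV s hs0)) h2
    gcongr
  rw [slope_def_field, ← neg_div, mul_div_assoc', le_div_iff₀ hsr]
  have h6 : (2 * (2 * Real.pi - Φ r)) * V s = 4 * Real.pi * ((1 - Φ r / (2 * Real.pi)) * V s) := by
    field_simp
    ring
  have e1 : Real.exp (2 * r - 2 * s) * Real.exp (2 * s) = Real.exp (2 * r) := by
    rw [← Real.exp_add]; congr 1; ring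
  have hE := Real.exp_pos (2 * r)
  calc 2 * (2 * Real.pi - Φ r) * V s * Real.exp (2 * r - 2 * s) * (s - r)
      = 4 * Real.pi * (s - r) * Real.exp (2 * r - 2 * s) * ((1 - Φ r / (2 * Real.pi)) * V s) := by
        rw [h6]; ring
    _ ≤ 4 * Real.pi * (s - r) * Real.exp (2 * r - 2 * s) * (Real.exp (2 * s) * A s) :=
        mul_le_mul_of_nonneg_left h5 (by positivity)
    _ = Real.exp (2 * r) * (4 * Real.pi * (s - r) * A s) := by rw [← e1]; ring
    _ ≤ Real.exp (2 * r) * (Φ r * (A r - A s)) := mul_le_mul_of_nonneg_left h1 hE.le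
    _ = Φ r * (Real.exp (2 * r) * (A r - A s)) := by ring
    _ ≤ Φ r * (V r - V s) := mul_le_mul_of_nonneg_left h4 (hΦ0 r hr)
    _ = Φ r * -(V s - V r) := by ring

/-- The bound for the height of a function whose superlevel sets satisfy the isoperimetric
inequality of a flat disk. -/
theorem LevelData.height_le (h : LevelData M A V Φ) (hM : 0 < M) (hΦ0 : ∀ t, 0 < t → 0 ≤ Φ t)
    (hV : ∀ t, 0 < t → 0 ≤ V t) {κ V₀ q : ℝ} (hκ0 : 0 ≤ κ) (hκ : κ < 2 * Real.pi) (hq : 0 < q)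
    (hV₀ : 0 < V₀) (hVV₀ : ∀ t, 0 < t → V t ≤ V₀)
    (hΦκ : ∀ t, 0 < t → Φ t ≤ κ * (V t / V₀) ^ (1 / q)) :
    M ≤ -(q / 2) * Real.log (1 - κ / (2 * Real.pi)) := by
  have hpi := Real.pi_pos
  set x := κ / (2 * Real.pi) with hx
  have hx0 : 0 ≤ x := div_nonneg hκ0 (by positivity)
  have hx1 : x < 1 := (div_lt_one (by positivity)).2 hκ
  have hκx : κ = 2 * Real.pi * x := by rw [hx]; field_simp
  set W : ℝ → ℝ := fun t => (V t / V₀) ^ (1 / q) with hW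
  have hW0 : ∀ t, 0 < t → 0 ≤ W t := fun t ht => Real.rpow_nonneg (div_nonneg (hV t ht) hV₀.le) _
  have hW1 : ∀ t, 0 < t → W t ≤ 1 := fun t ht =>
    Real.rpow_le_one (div_nonneg (hV t ht) hV₀.le) ((div_le_one hV₀).2 (hVV₀ t ht)) (by positivity)
  have hxW : ∀ t, 0 < t → x * W t ≤ x := fun t ht => mul_le_of_le_one_right hx0 (hW1 t ht)
  have hΦlt : ∀ t, 0 < t → Φ t < 2 * Real.pi := fun t ht => by
    have h1 := hΦκ t ht
    have h2 : κ * W t ≤ κ := mul_le_of_le_one_right hκ0 (hW1 t ht)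
    exact (h1.trans h2).trans_lt hκ
  have hVanti : ∀ t s, 0 < t → t ≤ s → V s ≤ V t := fun t s ht hts => by
    have h1 := h.le_vol t s ht hts
    have h2 := mul_nonneg (Real.exp_pos (2 * t)).le (sub_nonneg.2 (h.antitone_area t s ht hts))
    linarith
  -- Hölder's bound gives `Φ ≤ 2π x W`, and `slope_bound` then integrates to this logarithm: where
  -- `V` is differentiable, `H' = x W (-V') / (2 (1 - x W) V) ≥ 1`.
  set H : ℝ → ℝ := fun t => q / 2 * Real.log (1 - x * W t) with hH
  have hHmono : ∀ t s, 0 < t → t ≤ s → H t ≤ H s := by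
    intro t s ht hts
    have hs := ht.trans_le hts
    have h1 : W s ≤ W t := Real.rpow_le_rpow (div_nonneg (hV s hs) hV₀.le)
      (div_le_div_of_nonneg_right (hVanti t s ht hts) hV₀.le) (by positivity)
    refine mul_le_mul_of_nonneg_left (Real.log_le_log (by linarith [hxW t ht]) ?_) (by positivity)
    linarith [mul_le_mul_of_nonneg_left h1 hx0]
  have hderiv : ∀ r v', 0 < r → r < M → HasDerivAt V v' r → 1 ≤ deriv H r := by
    intro r v' hr hrM hd
    have hVr := h.vol_pos hr hrM hV
    have hWd : HasDerivAt W (v' / V₀ * (1 / q) * (V r / V₀) ^ (1 / q - 1)) r :=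
      (hd.div_const V₀).rpow_const (Or.inl (div_pos hVr hV₀).ne')
    have hpos : 0 < 1 - x * W r := by linarith [hxW r hr]
    have hHd := (((hWd.const_mul x).const_sub 1).log hpos.ne').const_mul (q / 2)
    rw [show deriv H r = _ from hHd.deriv]
    have hWr : 0 < W r := Real.rpow_pos_of_pos (div_pos hVr hV₀) _
    have e1 : (V r / V₀) ^ (1 / q - 1) = W r * (V₀ / V r) := by
      rw [Real.rpow_sub (div_pos hVr hV₀), Real.rpow_one]
      simp only [hW]
      field_simp
    have hv' : v' ≤ 0 := by
      by_contra hn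
      have hs : Tendsto (slope V r) (𝓝[>] r) (𝓝 v') :=
        hd.tendsto_slope.mono_left (nhdsWithin_mono r fun y (hy : r < y) => hy.ne')
      refine hn (le_of_tendsto hs ?_)
      filter_upwards [self_mem_nhdsWithin] with s (hs : r < s)
      rw [slope_def_field]
      exact div_nonpos_of_nonpos_of_nonneg (by linarith [hVanti r s hr hs.le]) (by linarith)
    have hb := h.slope_bound hΦ0 hΦlt hV hr hrM hd
    have hΦr : Φ r ≤ 2 * Real.pi * (x * W r) := by
      have := hΦκ r hr
      rw [hκx] at this
      linarith
    have hb2 : 2 * (2 * Real.pi - 2 * Real.pi * (x * W r)) * V r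
        ≤ 2 * Real.pi * (x * W r) * (-v') := by
      have e2 := mul_le_mul_of_nonneg_right hΦr hVr.le
      have e3 := mul_le_mul_of_nonneg_right hΦr (neg_nonneg.2 hv')
      linarith
    have hb3 : 2 * ((1 - x * W r) * V r) ≤ x * W r * (-v') := by
      have : 2 * Real.pi * (2 * ((1 - x * W r) * V r)) ≤ 2 * Real.pi * (x * W r * (-v')) := by
        linarith
      exact le_of_mul_le_mul_left this (by positivity)
    rw [e1, show q / 2 * (-(x * (v' / V₀ * (1 / q) * (W r * (V₀ / V r)))) / (1 - x * W r))
      = x * W r * (-v') / (2 * ((1 - x * W r) * V r)) by field_simp, le_div_iff₀ (by positivity),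
      one_mul]
    exact hb3
  -- `V` is only known to be monotone and may jump. It is differentiable almost everywhere, and for
  -- the increasing function `H` the integral of the derivative is at most the increment, which is
  -- the direction needed.
  have hstep : ∀ a b, 0 < a → a < b → b < M → b - a ≤ H b - H a := by
    intro a b ha hab hbM
    have hmonoH : MonotoneOn H (Set.uIcc a b) := by
      rw [Set.uIcc_of_le hab.le]
      exact fun t ht s _ hts => hHmono t s (ha.trans_le ht.1) hts
    have h1 := hmonoH.intervalIntegral_deriv_mem_uIcc
    rw [Set.uIcc_of_le (sub_nonneg.2 (hHmono a b ha hab.le))] at h1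
    have hae : ∀ᵐ r ∂volume.restrict (Set.Ioo a b), 1 ≤ deriv H r := by
      have hmV : MonotoneOn (fun t => -V t) (Set.Ioo a b) := fun t ht s _ hts =>
        neg_le_neg (hVanti t s (ha.trans ht.1) hts)
      have hdiff := hmV.ae_differentiableWithinAt measurableSet_Ioo
      filter_upwards [hdiff, ae_restrict_mem measurableSet_Ioo] with r hr hrm
      have h2 := (hr.differentiableAt (Ioo_mem_nhds hrm.1 hrm.2)).hasDerivAt.neg
      have h3 : HasDerivAt V _ r := h2.congr_of_eventuallyEq
        (Eventually.of_forall fun t => (neg_neg (V t)).symm)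
      exact hderiv r _ (ha.trans hrm.1) (hrm.2.trans hbM) h3
    have h4 : ∫ _ in a..b, (1:ℝ) ≤ ∫ r in a..b, deriv H r := by
      refine intervalIntegral.integral_mono_ae_restrict hab.le (by simp)
        hmonoH.intervalIntegrable_deriv ?_
      rwa [← restrict_Ioo_eq_restrict_Icc]
    simp only [intervalIntegral.integral_const, smul_eq_mul, mul_one] at h4
    exact h4.trans h1.2
  have hfin : ∀ a b, 0 < a → a < b → b < M → b - a ≤ -(q / 2) * Real.log (1 - x) := by
    intro a b ha hab hbM
    have hb0 := ha.trans hab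
    have h1 := hstep a b ha hab hbM
    have h2 : H b ≤ 0 := by
      refine mul_nonpos_of_nonneg_of_nonpos (by positivity)
        (Real.log_nonpos (by linarith [hxW b hb0]) ?_)
      linarith [mul_nonneg hx0 (hW0 b hb0)]
    have h3 : q / 2 * Real.log (1 - x) ≤ H a :=
      mul_le_mul_of_nonneg_left (Real.log_le_log (by linarith) (by linarith [hxW a ha]))
        (by positivity)
    linarith
  refine le_of_forall_pos_le_add fun ε hε => ?_
  have hm : 0 < min ε M := lt_min hε hM
  -- The endpoints `0` and `M` are approached from inside, at a total loss of at most `ε / 2`.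
  have h1 := hfin (min ε M / 4) (M - min ε M / 4) (by positivity)
    (by linarith [min_le_right ε M]) (by linarith)
  linarith [min_le_left ε M]

end Comparison

/-! ### Superlevel sets of the conformal factor. -/

section LevelSets

variable {G : Set Plane} {g g₀ : TensorField} {u : Plane → ℝ}

/-- The superlevel set `{u > t}` in `G`. -/
def superlevel (G : Set Plane) (u : Plane → ℝ) (t : ℝ) : Set Plane := {x | x ∈ G ∧ t < u x}

theorem superlevel_subset {t : ℝ} : superlevel G u t ⊆ G := fun _ hx => hx.1

theorem superlevel_anti {t s : ℝ} (h : t ≤ s) : superlevel G u s ⊆ superlevel G u t :=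
  fun _ hx => ⟨hx.1, h.trans_lt hx.2⟩

theorem isOpen_superlevel (hG : IsOpen G) (hu : ContinuousOn u G) (t : ℝ) :
    IsOpen (superlevel G u t) := hu.isOpen_inter_preimage hG isOpen_Ioi

theorem integrableOn_superlevel {t : ℝ} (hlev : IsCompact {x | x ∈ G ∧ t ≤ u x})
    {f : Plane → ℝ} (hf : ContinuousOn f G) : IntegrableOn f (superlevel G u t) :=
  ((hf.mono fun _ hx => hx.1).integrableOn_compact hlev).mono_set fun _ hx => ⟨hx.1, hx.2.le⟩

/-- A positive level is not attained on the frontier, where `u = 0`, so the set is closed in the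
compact set `closure G`. -/
theorem isCompact_level (hGo : IsOpen G) (hG : IsCompact (closure G))
    (hu : ContinuousOn u (closure G)) (hbdry : ∀ x ∈ frontier G, u x = 0) {t : ℝ} (ht : 0 < t) :
    IsCompact {x | x ∈ G ∧ t ≤ u x} := by
  have h1 : {x | x ∈ G ∧ t ≤ u x} = closure G ∩ u ⁻¹' Set.Ici t := by
    ext x
    refine ⟨fun hx => ⟨subset_closure hx.1, hx.2⟩, fun hx => ⟨?_, hx.2⟩⟩
    by_contra hn
    have hf : x ∈ frontier G := by
      rw [hGo.frontier_eq]
      exact ⟨hx.1, hn⟩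
    have h2 : t ≤ u x := hx.2
    rw [hbdry x hf] at h2
    linarith
  rw [h1]
  exact hG.of_isClosed_subset (hu.preimage_isClosed_of_isClosed isClosed_closure isClosed_Ici)
    Set.inter_subset_left

theorem setIntegral_diff_superlevel (hG : IsOpen G) (hu : ContinuousOn u G) {t s : ℝ}
    (hlev : IsCompact {x | x ∈ G ∧ t ≤ u x}) (hts : t ≤ s) {f : Plane → ℝ}
    (hf : ContinuousOn f G) :
    ∫ x in superlevel G u t \ superlevel G u s, f x
      = (∫ x in superlevel G u t, f x) - ∫ x in superlevel G u s, f x :=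
  setIntegral_sdiff (isOpen_superlevel hG hu s).measurableSet (integrableOn_superlevel hlev hf)
    (superlevel_anti hts)

/-- The isoperimetric inequality for the superlevel sets of the conformal factor. -/
theorem IsDevelopingMap.superlevel_isoperimetric {F₁ F₂ : Plane → ℝ}
    (hF : IsDevelopingMap G g₀ F₁ F₂) (hG : IsOpen G)
    (hg : IsRiemannianMetricOn g G) (hg₀ : IsRiemannianMetricOn g₀ G) (hflat : IsFlatOn g₀ G)
    (hconf : ∀ x ∈ G, g x = Real.exp (2 * u x) • g₀ x) {t s : ℝ} (hts : t < s)
    (hlev : IsCompact {x | x ∈ G ∧ t ≤ u x}) (hlev' : IsCompact {x | x ∈ G ∧ s ≤ u x}) :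
    4 * Real.pi * (s - t) * ∫ x in superlevel G u s, Real.sqrt (g₀ x).det
      ≤ (∫ x in superlevel G u t, max (gaussCurvature g x) 0 * Real.sqrt (g x).det)
        * ((∫ x in superlevel G u t, Real.sqrt (g₀ x).det)
          - ∫ x in superlevel G u s, Real.sqrt (g₀ x).det) := by
  have hu := contDiffOn_of_conformal hg hg₀ hconf
  have cS : ContinuousOn (fun x => Real.sqrt (g₀ x).det) G := hg₀.contDiffOn_sqrt_det.continuousOn
  set A := ∫ x in superlevel G u s, Real.sqrt (g₀ x).det with hA
  set Φ := ∫ x in superlevel G u t, max (gaussCurvature g x) 0 * Real.sqrt (g x).det with hΦ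
  have hA0 : 0 ≤ A := integral_nonneg fun x => Real.sqrt_nonneg _
  have hΦ0 : 0 ≤ Φ := integral_nonneg fun x => mul_nonneg (le_max_right _ _) (Real.sqrt_nonneg _)
  set B := ∫ x in superlevel G u t \ superlevel G u s, Real.sqrt (g₀ x).det with hB
  rw [← setIntegral_diff_superlevel hG hu.continuousOn hlev hts.le cS, ← hB]
  have hAE : A ≤ ∫ x in {x | x ∈ G ∧ s ≤ u x}, Real.sqrt (g₀ x).det :=
    setIntegral_mono_set ((cS.mono fun _ hx => hx.1).integrableOn_compact hlev')
      (Eventually.of_forall fun x => Real.sqrt_nonneg _)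
      (Eventually.of_forall fun x hx => ⟨hx.1, le_of_lt hx.2⟩)
  -- The isoperimetric inequality has `ramp²` on the left, the energy bound has one factor `ramp` on
  -- the right; cancelling it and letting `δ → 0` leaves `s - t`.
  have main : ∀ δ : ℝ, 0 < δ → 2 * δ < s - t → 4 * Real.pi * (s - t - 2 * δ) * A ≤ Φ * B := by
    intro δ hδ hδs
    have hI : s - t - 2 * δ ≤ ramp t s δ s := le_ramp hδ hδs.le
    have hI0 : 0 < ramp t s δ s := by linarith
    have h1 := hF.isoperimetric hG hg₀ hu hlev hlev' hδ
    have h2 := integral_trapezoid_mul_energyDensity_le (s := s) hG hg hg₀ hflat hconf hlev hδ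
    have h3 : ∫ x in G, trapezoid t s δ (u x) * Real.sqrt (g₀ x).det ≤ B := by
      rw [setIntegral_eq_of_subset_of_forall_sdiff_eq_zero hG.measurableSet
        (Set.sdiff_subset.trans superlevel_subset : superlevel G u t \ superlevel G u s ⊆ G)
        fun x hx => ?_]
      · have hi := (integrableOn_superlevel hlev cS).mono_set
          (Set.sdiff_subset : superlevel G u t \ superlevel G u s ⊆ _)
        have cη : ContinuousOn (fun x => trapezoid t s δ (u x)) G :=
          (continuous_trapezoid t s δ).comp_continuousOn hu.continuousOn
        refine setIntegral_mono_on ((integrableOn_superlevel hlev (cη.mul cS)).mono_set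
          Set.sdiff_subset) hi
          ((isOpen_superlevel hG hu.continuousOn t).measurableSet.diff
            (isOpen_superlevel hG hu.continuousOn s).measurableSet) fun x _ => ?_
        exact mul_le_of_le_one_left (Real.sqrt_nonneg _) (trapezoid_le_one _ _ _ _)
      · have : u x ≤ t ∨ s ≤ u x := by
          by_contra hn
          rw [not_or, not_le, not_le] at hn
          exact hx.2 ⟨⟨hx.1, hn.1⟩, fun h => absurd h.2 (not_lt.2 hn.2.le)⟩
        rw [trapezoid_eq_zero hδ this, zero_mul]
    have h4 : 0 ≤ ∫ x in G, trapezoid t s δ (u x) * Real.sqrt (g₀ x).det :=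
      integral_nonneg fun x => mul_nonneg (trapezoid_nonneg _ _ _ _) (Real.sqrt_nonneg _)
    have h5 : ramp t s δ s * (4 * Real.pi * ramp t s δ s * A)
        ≤ ramp t s δ s * (Φ * B) := by
      calc ramp t s δ s * (4 * Real.pi * ramp t s δ s * A)
          = 4 * Real.pi * ramp t s δ s ^ 2 * A := by ring
        _ ≤ 4 * Real.pi * ramp t s δ s ^ 2 * ∫ x in {x | x ∈ G ∧ s ≤ u x}, Real.sqrt (g₀ x).det :=
            mul_le_mul_of_nonneg_left hAE (by positivity)
        _ ≤ _ := h1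
        _ ≤ (ramp t s δ s * Φ) * B := mul_le_mul h2 h3 h4 (mul_nonneg hI0.le hΦ0)
        _ = _ := by ring
    refine le_trans ?_ (le_of_mul_le_mul_left h5 hI0)
    refine mul_le_mul_of_nonneg_right ?_ hA0
    exact mul_le_mul_of_nonneg_left hI (by positivity)
  have ht : Tendsto (fun δ : ℝ => 4 * Real.pi * (s - t - 2 * δ) * A) (𝓝[>] 0)
      (𝓝 (4 * Real.pi * (s - t - 2 * 0) * A)) :=
    (Continuous.tendsto (by fun_prop) 0).mono_left nhdsWithin_le_nhds
  rw [mul_zero, sub_zero] at ht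
  refine le_of_tendsto ht ?_
  filter_upwards [Ioo_mem_nhdsGT (show (0:ℝ) < (s - t) / 2 by linarith)] with δ hδ
  exact main δ hδ.1 (by linarith [hδ.2])

/-- The volume comparisons hold because `√det g = e^{2u} √det g₀`, with `e^{2u}` between `e^{2t}`
and `e^{2s}` on `{t < u ≤ s}`. -/
theorem IsDevelopingMap.levelData {F₁ F₂ : Plane → ℝ}
    (hF : IsDevelopingMap G g₀ F₁ F₂) (hG : IsOpen G)
    (hg : IsRiemannianMetricOn g G) (hg₀ : IsRiemannianMetricOn g₀ G) (hflat : IsFlatOn g₀ G)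
    (hconf : ∀ x ∈ G, g x = Real.exp (2 * u x) • g₀ x)
    (hlev : ∀ t, 0 < t → IsCompact {x | x ∈ G ∧ t ≤ u x}) {M : ℝ} (hM : ∀ x ∈ G, u x ≤ M)
    (hne : ∀ t, t < M → (superlevel G u t).Nonempty) :
    LevelData M (fun t => ∫ x in superlevel G u t, Real.sqrt (g₀ x).det)
      (fun t => ∫ x in superlevel G u t, Real.sqrt (g x).det)
      (fun t => ∫ x in superlevel G u t, max (gaussCurvature g x) 0 * Real.sqrt (g x).det) := by
  have hu := (contDiffOn_of_conformal hg hg₀ hconf).continuousOn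
  have c₀ : ContinuousOn (fun x => Real.sqrt (g₀ x).det) G := hg₀.contDiffOn_sqrt_det.continuousOn
  have c : ContinuousOn (fun x => Real.sqrt (g x).det) G := hg.contDiffOn_sqrt_det.continuousOn
  have cK : ContinuousOn (fun x => max (gaussCurvature g x) 0 * Real.sqrt (g x).det) G :=
    ((continuousOn_gaussCurvature hG hg).sup continuousOn_const).mul c
  have hms : ∀ t, MeasurableSet (superlevel G u t) := fun t => (isOpen_superlevel hG hu t).measurableSet
  have hsq := fun x (hx : x ∈ G) => sqrt_det_conformal hconf hx
  refine ⟨?_, ?_, ?_, ?_, ?_, ?_, ?_⟩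
  · intro t s ht hts _
    exact hF.superlevel_isoperimetric hG hg hg₀ hflat hconf hts (hlev t ht) (hlev s (ht.trans hts))
  · intro t s ht hts
    rw [← setIntegral_diff_superlevel hG hu (hlev t ht) hts c₀,
      ← setIntegral_diff_superlevel hG hu (hlev t ht) hts c, ← integral_const_mul]
    refine setIntegral_mono_on
      (((integrableOn_superlevel (hlev t ht) c₀).mono_set Set.sdiff_subset).const_mul _)
      ((integrableOn_superlevel (hlev t ht) c).mono_set Set.sdiff_subset)
      ((hms t).diff (hms s)) fun x hx => ?_
    rw [hsq x hx.1.1]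
    exact mul_le_mul_of_nonneg_right (Real.exp_le_exp.2 (by linarith [hx.1.2])) (Real.sqrt_nonneg _)
  · intro t s ht hts
    rw [← setIntegral_diff_superlevel hG hu (hlev t ht) hts c₀,
      ← setIntegral_diff_superlevel hG hu (hlev t ht) hts c, ← integral_const_mul]
    refine setIntegral_mono_on
      ((integrableOn_superlevel (hlev t ht) c).mono_set Set.sdiff_subset)
      (((integrableOn_superlevel (hlev t ht) c₀).mono_set Set.sdiff_subset).const_mul _)
      ((hms t).diff (hms s)) fun x hx => ?_
    rw [hsq x hx.1.1]
    have hus : u x ≤ s := le_of_not_gt fun h => hx.2 ⟨hx.1.1, h⟩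
    exact mul_le_mul_of_nonneg_right (Real.exp_le_exp.2 (by linarith)) (Real.sqrt_nonneg _)
  · intro t ht
    rw [← integral_const_mul]
    refine setIntegral_mono_on (integrableOn_superlevel (hlev t ht) c)
      ((integrableOn_superlevel (hlev t ht) c₀).const_mul _) (hms t) fun x hx => ?_
    rw [hsq x hx.1]
    exact mul_le_mul_of_nonneg_right (Real.exp_le_exp.2 (by linarith [hM x hx.1]))
      (Real.sqrt_nonneg _)
  · intro t ht htM
    rw [setIntegral_pos_iff_support_of_nonneg_ae
      (Eventually.of_forall fun x => Real.sqrt_nonneg _) (integrableOn_superlevel (hlev t ht) c₀)]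
    refine ((isOpen_superlevel hG hu t).measure_pos volume (hne t htM)).trans_le
      (measure_mono fun x hx => ⟨?_, hx⟩)
    exact (Real.sqrt_pos.2 (hg₀.det_pos hx.1)).ne'
  · intro t s ht hts
    exact setIntegral_mono_set (integrableOn_superlevel (hlev t ht) c₀)
      (Eventually.of_forall fun x => Real.sqrt_nonneg _)
      (Eventually.of_forall (superlevel_anti hts))
  · intro t s ht hts
    exact setIntegral_mono_set (integrableOn_superlevel (hlev t ht) cK)
      (Eventually.of_forall fun x => mul_nonneg (le_max_right _ _) (Real.sqrt_nonneg _))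
      (Eventually.of_forall (superlevel_anti hts))

end LevelSets

/-! ### Area measure and Hölder's inequality. -/

section Area

variable {G L : Set Plane} {g : TensorField}

theorem setLIntegral_areaMeasure (hg : IsRiemannianMetricOn g G)
    (hL : MeasurableSet L) (hLG : L ⊆ G) {f : Plane → ℝ} (hf : ContinuousOn f G)
    (hf0 : ∀ x, 0 ≤ f x) (hint : IntegrableOn (fun x => f x * Real.sqrt (g x).det) L) :
    ∫⁻ x in L, ENNReal.ofReal (f x) ∂areaMeasure G g
      = ENNReal.ofReal (∫ x in L, f x * Real.sqrt (g x).det) := by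
  have hS : AEMeasurable (fun x => ENNReal.ofReal (Real.sqrt (g x).det)) (volume.restrict L) :=
    ((hg.contDiffOn_sqrt_det.continuousOn.mono hLG).aemeasurable hL).ennreal_ofReal
  have hfm : AEMeasurable (fun x => ENNReal.ofReal (f x)) (volume.restrict L) :=
    ((hf.mono hLG).aemeasurable hL).ennreal_ofReal
  rw [areaMeasure, restrict_withDensity hL, Measure.restrict_restrict hL,
    Set.inter_eq_left.2 hLG, lintegral_withDensity_eq_lintegral_mul₀ hS hfm,
    ofReal_integral_eq_lintegral_ofReal hint
      (Eventually.of_forall fun x => mul_nonneg (hf0 x) (Real.sqrt_nonneg _))]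
  refine lintegral_congr fun x => ?_
  rw [Pi.mul_apply, ENNReal.ofReal_mul (hf0 x), mul_comm]

theorem areaMeasure_apply_eq (hg : IsRiemannianMetricOn g G)
    (hL : MeasurableSet L) (hLG : L ⊆ G) (hint : IntegrableOn (fun x => Real.sqrt (g x).det) L) :
    areaMeasure G g L = ENNReal.ofReal (∫ x in L, Real.sqrt (g x).det) := by
  have h := setLIntegral_areaMeasure hg hL hLG (f := fun _ => 1) continuousOn_const
    (fun _ => zero_le_one) (by simpa using hint)
  simpa using h

/-- Hölder's inequality for the positive part of the curvature. -/
theorem ofReal_integral_curvature_le (hG : IsOpen G) (hg : IsRiemannianMetricOn g G)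
    (hL : MeasurableSet L) (hLG : L ⊆ G) (hint : IntegrableOn (fun x => Real.sqrt (g x).det) L)
    (hintK : IntegrableOn (fun x => max (gaussCurvature g x) 0 * Real.sqrt (g x).det) L)
    {p : ℝ} (hp : 1 < p) :
    ENNReal.ofReal (∫ x in L, max (gaussCurvature g x) 0 * Real.sqrt (g x).det)
      ≤ eLpNorm (fun x => max (gaussCurvature g x) 0) (ENNReal.ofReal p) (areaMeasure G g)
        * ENNReal.ofReal (∫ x in L, Real.sqrt (g x).det) ^ (1 - 1 / p) := by
  have cK : ContinuousOn (fun x => max (gaussCurvature g x) 0) G :=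
    (continuousOn_gaussCurvature hG hg).sup continuousOn_const
  have hac : (areaMeasure G g).restrict L ≪ volume.restrict L := by
    rw [areaMeasure, restrict_withDensity hL, Measure.restrict_restrict hL,
      Set.inter_eq_left.2 hLG]
    exact withDensity_absolutelyContinuous _ _
  have hm : AEStronglyMeasurable (fun x => max (gaussCurvature g x) 0)
      ((areaMeasure G g).restrict L) :=
    ((cK.mono hLG).aestronglyMeasurable hL).mono_ac hac
  rw [← setLIntegral_areaMeasure hg hL hLG cK (fun _ => le_max_right _ _) hintK,
    ← areaMeasure_apply_eq hg hL hLG hint]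
  have h1 : ∫⁻ x in L, ENNReal.ofReal (max (gaussCurvature g x) 0) ∂areaMeasure G g
      = eLpNorm (fun x => max (gaussCurvature g x) 0) 1 ((areaMeasure G g).restrict L) := by
    rw [eLpNorm_one_eq_lintegral_enorm]
    refine lintegral_congr fun x => ?_
    rw [Real.enorm_of_nonneg (le_max_right _ _)]
  have h2 := eLpNorm_le_eLpNorm_mul_rpow_measure_univ (p := 1) (q := ENNReal.ofReal p)
    (by rw [← ENNReal.ofReal_one]; exact ENNReal.ofReal_le_ofReal hp.le) hm
  rw [h1]
  refine h2.trans ?_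
  rw [Measure.restrict_apply_univ, ENNReal.toReal_one, ENNReal.toReal_ofReal (by linarith),
    div_one]
  gcongr
  exact Measure.restrict_le_self

end Area

/-! ### From the logarithmic height bound to the stated estimate. -/

/-- With `x = κ / 2π`, split `q = 1 + (q - 1)`. The first part is the logarithmic term; in the
second, `-log (1 - x) ≤ x / (1 - x)` and `q - 1 ≤ q log q`. -/
theorem log_bound_le {κ q : ℝ} (hκ0 : 0 ≤ κ) (hκ : κ < 2 * Real.pi) (hq : 1 < q) :
    -(q / 2) * Real.log (1 - κ / (2 * Real.pi))
      ≤ 1 / 2 * |Real.log (1 - κ / (2 * Real.pi))|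
        + κ / (4 * Real.pi - 2 * κ) * (q * Real.log q) := by
  have hpi := Real.pi_pos
  set x := κ / (2 * Real.pi) with hx
  have hx0 : 0 ≤ x := div_nonneg hκ0 (by positivity)
  have hx1 : x < 1 := (div_lt_one (by positivity)).2 hκ
  have hκx : κ = 2 * Real.pi * x := by rw [hx]; field_simp
  have h1 : κ / (4 * Real.pi - 2 * κ) = x / (1 - x) / 2 := by
    rw [hκx, show 4 * Real.pi - 2 * (2 * Real.pi * x) = 4 * Real.pi * (1 - x) by ring]
    have : 1 - x ≠ 0 := by linarith
    field_simp
    ring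
  have hpos : 0 < 1 - x := by linarith
  have h2 : -Real.log (1 - x) ≤ x / (1 - x) := by
    have := Real.one_sub_inv_le_log_of_pos hpos
    have e : x / (1 - x) = (1 - x)⁻¹ - 1 := by field_simp; ring
    linarith
  have h3 : q - 1 ≤ q * Real.log q := by
    have := mul_le_mul_of_nonneg_left (Real.one_sub_inv_le_log_of_pos (by linarith : 0 < q))
      (by linarith : 0 ≤ q)
    rw [mul_sub, mul_inv_cancel₀ (by linarith)] at this
    linarith
  have h4 : Real.log (1 - x) ≤ 0 := Real.log_nonpos hpos.le (by linarith)
  have h5 : (q - 1) * -Real.log (1 - x) ≤ q * Real.log q * (x / (1 - x)) :=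
    mul_le_mul h3 h2 (by linarith) (by linarith)
  rw [abs_of_nonpos h4, h1]
  linarith

theorem mainTheorem6 (G : Set Plane) (hG : IsSmoothDiskDomain G)
    (g g₀ : TensorField) (hg : IsRiemannianMetricOn g G) (hg₀ : IsRiemannianMetricOn g₀ G)
    (hflat : IsFlatOn g₀ G)
    (u : Plane → ℝ) (hu : ContinuousOn u (closure G))
    (hconf : ∀ x ∈ G, g x = Real.exp (2 * u x) • g₀ x)
    (hbdry : ∀ x ∈ frontier G, u x = 0)
    (p q : ℝ) (hp : 1 < p) (hq : q = p / (p - 1))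
    (hK : curvPlus p G g < ENNReal.ofReal (2 * Real.pi)) :
    ∃ M : ℝ, IsGreatest (u '' closure G) M ∧
      M ≤ (1 / 2) * |Real.log (1 - (curvPlus p G g).toReal / (2 * Real.pi))|
        + (curvPlus p G g).toReal / (4 * Real.pi - 2 * (curvPlus p G g).toReal)
          * (q * Real.log q) := by
  have hpi := Real.pi_pos
  have hGo := hG.1
  have hcpt : IsCompact (closure G) := by
    obtain ⟨-, φ, -, hφ, -, hbij, -, -⟩ := hG
    rw [← hbij.image_eq]
    exact (isCompact_closedBall _ _).image_of_continuousOn hφ.continuousOn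
  have hGne : G.Nonempty := by
    obtain ⟨-, φ, -, -, -, -, -, himg⟩ := hG
    rw [← himg]
    exact (Metric.nonempty_ball.2 one_pos).image φ
  obtain ⟨x₀, hx₀, hmax⟩ := hcpt.exists_isMaxOn hGne.closure hu
  refine ⟨u x₀, ⟨Set.mem_image_of_mem u hx₀, ?_⟩, ?_⟩
  · rintro _ ⟨y, hy, rfl⟩
    exact hmax hy
  set κ := (curvPlus p G g).toReal with hκdef
  have hκ0 : 0 ≤ κ := ENNReal.toReal_nonneg
  have hκ : κ < 2 * Real.pi := by
    have := (ENNReal.toReal_lt_toReal (hK.trans ENNReal.ofReal_lt_top).ne ENNReal.ofReal_ne_top).2 hK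
    rwa [ENNReal.toReal_ofReal (by positivity)] at this
  have hp1 : 0 < p - 1 := by linarith
  have hq1 : 1 < q := by
    rw [hq, lt_div_iff₀ hp1]
    linarith
  have hqp : 1 - 1 / p = 1 / q := by
    rw [hq]
    field_simp
  refine le_trans ?_ (log_bound_le hκ0 hκ hq1)
  -- If the maximum is not positive there are no positive superlevel sets, and the bound holds
  -- because its right side is nonnegative.
  rcases le_or_gt (u x₀) 0 with hneg | hM
  · have hx1 : κ / (2 * Real.pi) < 1 := (div_lt_one (by positivity)).2 hκ
    have hx0 : 0 ≤ κ / (2 * Real.pi) := by positivity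
    have := Real.log_nonpos (by linarith : 0 ≤ 1 - κ / (2 * Real.pi)) (by linarith)
    nlinarith
  obtain ⟨F₁, F₂, hF⟩ := hG.exists_developing hg₀ hflat
  have hlev : ∀ t, 0 < t → IsCompact {x | x ∈ G ∧ t ≤ u x} := fun t ht =>
    isCompact_level hGo hcpt hu hbdry ht
  have hx₀G : x₀ ∈ G := by
    by_contra hn
    have : u x₀ = 0 := hbdry x₀ (by rw [hGo.frontier_eq]; exact ⟨hx₀, hn⟩)
    linarith
  have hdata := IsDevelopingMap.levelData hF hGo hg hg₀ hflat hconf hlev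
    (fun x hx => hmax (subset_closure hx)) (fun t ht => ⟨x₀, hx₀G, ht⟩)
  set V : ℝ → ℝ := fun t => ∫ x in superlevel G u t, Real.sqrt (g x).det with hVdef
  set Φ : ℝ → ℝ := fun t => ∫ x in superlevel G u t,
    max (gaussCurvature g x) 0 * Real.sqrt (g x).det with hΦdef
  have huG : ContinuousOn u G := hu.mono subset_closure
  have c : ContinuousOn (fun x => Real.sqrt (g x).det) G := hg.contDiffOn_sqrt_det.continuousOn
  have cK : ContinuousOn (fun x => max (gaussCurvature g x) 0 * Real.sqrt (g x).det) G :=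
    ((continuousOn_gaussCurvature hGo hg).sup continuousOn_const).mul c
  have hV0 : ∀ t, 0 < t → 0 ≤ V t := fun t _ => integral_nonneg fun x => Real.sqrt_nonneg _
  have hΦ0 : ∀ t, 0 < t → 0 ≤ Φ t := fun t _ =>
    integral_nonneg fun x => mul_nonneg (le_max_right _ _) (Real.sqrt_nonneg _)
  set N := eLpNorm (fun x => max (gaussCurvature g x) 0) (ENNReal.ofReal p) (areaMeasure G g)
    with hN
  have hHolder : ∀ t, 0 < t → ENNReal.ofReal (Φ t) ≤ N * ENNReal.ofReal (V t) ^ (1 / q) := by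
    intro t ht
    rw [← hqp]
    exact ofReal_integral_curvature_le hGo hg (isOpen_superlevel hGo huG t).measurableSet
      superlevel_subset (integrableOn_superlevel (hlev t ht) c)
      (integrableOn_superlevel (hlev t ht) cK) hp
  have harea : ∀ t, 0 < t → ENNReal.ofReal (V t) ≤ areaMeasure G g G := fun t ht => by
    rw [hVdef, ← areaMeasure_apply_eq hg (isOpen_superlevel hGo huG t).measurableSet
      superlevel_subset (integrableOn_superlevel (hlev t ht) c)]
    exact measure_mono superlevel_subset
  have hcurv : curvPlus p G g = N * areaMeasure G g G ^ (1 / q) := by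
    rw [curvPlus, hqp]
  have hfin : N * areaMeasure G g G ^ (1 / q) ≠ ⊤ := by
    rw [← hcurv]
    exact (hK.trans ENNReal.ofReal_lt_top).ne
  have hqpos : 0 < 1 / q := by positivity
  have hareapos : areaMeasure G g G ≠ 0 := fun h0 => by
    have h1 := harea (u x₀ / 2) (by linarith)
    rw [h0, nonpos_iff_eq_zero, ENNReal.ofReal_eq_zero] at h1
    linarith [hdata.vol_pos (t := u x₀ / 2) (by linarith) (by linarith) hV0]
  -- With infinite area, finiteness of the curvature quantity (where `0 · ∞ = 0`) forces the
  -- curvature norm to vanish. Then `Φ = 0`, against the isoperimetric inequality and the positive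
  -- area of superlevel sets.
  have hareafin : areaMeasure G g G ≠ ⊤ := fun htop => by
    rw [htop, ENNReal.top_rpow_of_pos hqpos] at hfin
    have hN0 : N = 0 := by
      by_contra hne
      exact hfin (ENNReal.mul_top hne)
    have h1 := hHolder (u x₀ / 4) (by linarith)
    rw [hN0, zero_mul, nonpos_iff_eq_zero, ENNReal.ofReal_eq_zero] at h1
    have h2 := hdata.isoperimetric (u x₀ / 4) (u x₀ / 2) (by linarith) (by linarith) (by linarith)
    have h3 := hdata.area_pos (u x₀ / 2) (by linarith) (by linarith)
    rw [le_antisymm h1 (hΦ0 _ (by linarith)), zero_mul] at h2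
    have h4 := mul_pos (mul_pos (by positivity : 0 < 4 * Real.pi)
      (by linarith : 0 < u x₀ / 2 - u x₀ / 4)) h3
    linarith
  set V₀ := (areaMeasure G g G).toReal with hV₀
  have hV₀pos : 0 < V₀ := ENNReal.toReal_pos hareapos hareafin
  have hNfin : N ≠ ⊤ := fun htop => hfin (by
    rw [htop]
    exact ENNReal.top_mul (by simp [hareapos, hareafin]))
  refine hdata.height_le hM hΦ0 hV0 hκ0 hκ (by linarith) hV₀pos (fun t ht => ?_) fun t ht => ?_
  · exact (ENNReal.ofReal_le_iff_le_toReal hareafin).1 (harea t ht)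
  -- Normalising by the total area turns Hölder's bound `Φ ≤ N V^{1/q}` into `Φ ≤ κ (V/V₀)^{1/q}`.
  · have hκN : κ = N.toReal * V₀ ^ (1 / q) := by
      rw [hκdef, hcurv, ENNReal.toReal_mul, ENNReal.toReal_rpow]
    have h1 := ENNReal.toReal_mono (ENNReal.mul_ne_top hNfin
      (ENNReal.rpow_ne_top_of_nonneg hqpos.le ENNReal.ofReal_ne_top)) (hHolder t ht)
    rw [ENNReal.toReal_mul, ← ENNReal.toReal_rpow, ENNReal.toReal_ofReal (hΦ0 t ht),
      ENNReal.toReal_ofReal (hV0 t ht)] at h1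
    rw [Real.div_rpow (hV0 t ht) hV₀pos.le, hκN]
    have : V₀ ^ (1 / q) ≠ 0 := (Real.rpow_pos_of_pos hV₀pos _).ne'
    calc Φ t ≤ N.toReal * V t ^ (1 / q) := h1
      _ = _ := by field_simp
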